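/- Let $\lambda(\tau)=\bigl(\theta_2(\tau)/\theta_3(\tau)\bigr)^4$ for $\tau$ in the upper half plane $\mathbb H$, where $\theta_2(\tau)=\sum_{n\in\mathbb Z}q^{(n-1/2)^2}$, $\theta_3(\tau)=\sum_{n\in\mathbb Z}q^{n^2}$ and $q=e^{\pi i\tau}$. Let $R,S$ be polynomials with real coefficients, $R$ of odd degree and $S$ of even degree, such that (1) $R(1-x)+R(x)=S(x)$; (2) every complex zero of $R(x)S'(x)-R'(x)S(x)$ is equal to $0$ or $1$; (3) $S$ has no real zeros $x$ with $0<x<1$; (4) $S(1)=R(1)\neq 0$. Then there are a finite index subgroup $\Gamma$ of $\Gamma(2)$ (the $\lambda$-group) and a modular function $\phi$ of weight zero for $\Gamma$ (a $\Gamma$-invariant meromorphic function on $\mathbb H$ that is meromorphic at all cusps), holomorphic on $\mathbb H$, such that for all $\tau\in\mathbb H$ $$R(\phi(\tau))-\lambda(\tau)S(\phi(\tau))=0,\qquad \phi(\tau)+\phi(-1/\tau)=1,$$ and $\phi(0)=1$, $\phi(i\infty)=0$, $\phi(i)=1/2$, where $\phi(0)$ and $\phi(i\infty)$ are the values at the cusps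 $0$ and $i\infty$, i.e. $\phi(-1/\tau)\to1$ and $\phi(\tau)\to0$ as $\operatorname{Im}\tau\to\infty$. -/

import Mathlib

open UpperHalfPlane
open scoped MatrixGroups

noncomputable section

/-- The theta constant `θ₂(τ) = ∑_{n ∈ ℤ} q^{(n - 1/2)²}`, where `q = exp(π i τ)`. -/
def thetaTwo (τ : ℍ) : ℂ :=
  ∑' n : ℤ, Complex.exp (Real.pi * Complex.I * ((n : ℂ) - 1 / 2) ^ 2 * (τ : ℂ))

/-- The theta constant `θ₃(τ) = ∑_{n ∈ ℤ} q^{n²}`, where `q = exp(π i τ)`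
(this is Mathlib's `jacobiTheta`). -/
def thetaThree (τ : ℍ) : ℂ := jacobiTheta (τ : ℂ)

/-- The modular lambda function `λ = (θ₂ / θ₃)⁴`. -/
def lambdaFun (τ : ℍ) : ℂ := (thetaTwo τ / thetaThree τ) ^ 4

/-- `f` is meromorphic at the cusps: for every `g ∈ SL(2, ℤ)` the function `τ ↦ f (g τ)` is, near
`i∞`, a meromorphic function of `exp(2 π i τ / N)` at `0` for some integer `N > 0`. -/
def IsMeromorphicAtCusps (f : ℍ → ℂ) : Prop :=
  ∀ g : SL(2, ℤ), ∃ N : ℕ, 0 < N ∧ ∃ F : ℂ → ℂ, MeromorphicAt F 0 ∧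
    ∀ᶠ τ in atImInfty, f (g • τ) = F (Complex.exp (2 * Real.pi * Complex.I * (τ : ℂ) / (N : ℂ)))

/-- `f` is a modular function (of weight zero) for the finite index subgroup `Γ` of `SL(2, ℤ)`:
it is meromorphic on the upper half plane, `Γ`-invariant, and meromorphic at all cusps. -/
structure IsModularFunction (Γ : Subgroup SL(2, ℤ)) (f : ℍ → ℂ) : Prop where
  meromorphic : MeromorphicOn (fun z : ℂ => f (ofComplex z)) {z : ℂ | 0 < z.im}
  invariant : ∀ γ ∈ Γ, ∀ τ : ℍ, f (γ • τ) = f τ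
  meromorphicAtCusps : IsMeromorphicAtCusps f

/-- `f` takes the value `v` at the cusp `c ∈ ℚ ∪ {∞}`: for every `g ∈ SL(2, ℤ)` with `g ∞ = c`,
`f (g τ)` tends to `v` as `Im τ → ∞` (uniformly in `Re τ`). -/
def HasValueAtCusp (f : ℍ → ℂ) (c : OnePoint ℝ) (v : ℂ) : Prop :=
  ∀ g : SL(2, ℤ), Matrix.SpecialLinearGroup.mapGL ℝ g • (OnePoint.infty : OnePoint ℝ) = c →
    Filter.Tendsto (fun τ : ℍ => f (g • τ)) atImInfty (nhds v)

end

/-! The function `φ` is a lift of `λ` through the rational map `R/S`. The parities and (1) give deg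
S < deg R, so `R/S` is proper off its poles. By (2) its critical points lie in {0, 1}, where (1) and
(4) give it the values 0 and 1. Hence `R/S` is a covering over ℂ ∖ {0, 1} (`isCoveringMapOn_ratio`).

Jacobi's identity and the non-vanishing of the theta constants show that `λ` omits 0 and 1. As ℍ is
simply connected, `λ` lifts, and `φ(i) = 1/2` is an admissible start because λ(i) = 1/2 and 2R(1/2)
= S(1/2).

A lift is determined by one value, and the symmetries follow. Translates of `φ` by Γ(2) are lifts,
told apart by their values in the finite fibre over λ(i), so the stabilizer of `φ` has finite index.
Both 1 - φ(-1/τ) and the conjugate of φ(-τ̄) are lifts equal to 1/2 at i, so they are `φ`.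

At the cusps `φ` is periodic and grows at most like `λ`, hence is meromorphic there. On the
imaginary axis `φ` is real and omits 0 and 1, so it stays between them. Its limit at i∞ is therefore
a zero of R in [0, 1], and Rolle's theorem for `R/S`, with (2) and (3), leaves only 0. -/

/-! ### Products of theta series, duplication formulas, Jacobi's identity -/

/-- Pairs with even sum are uniquely (a + b, a - b), those with odd sum (a + b + 1, a - b). In these
coordinates m² + n² has no cross term, which produces theta series at 2τ. -/
theorem Int.hasSum_prod_of_parity {f : ℤ × ℤ → ℂ} {a b : ℂ}
    (ha : HasSum (fun p : ℤ × ℤ => f (p.1 + p.2, p.1 - p.2)) a)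
    (hb : HasSum (fun p : ℤ × ℤ => f (p.1 + p.2 + 1, p.1 - p.2)) b) :
    HasSum f (a + b) := by
  have i1 : Function.Injective (fun p : ℤ × ℤ => (p.1 + p.2, p.1 - p.2)) := by
    rintro ⟨a, b⟩ ⟨c, d⟩ h
    simp only [Prod.mk.injEq] at h ⊢
    omega
  have i2 : Function.Injective (fun p : ℤ × ℤ => (p.1 + p.2 + 1, p.1 - p.2)) := by
    rintro ⟨a, b⟩ ⟨c, d⟩ h
    simp only [Prod.mk.injEq] at h ⊢
    omega
  have hc : IsCompl (Set.range (fun p : ℤ × ℤ => (p.1 + p.2, p.1 - p.2)))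
      (Set.range (fun p : ℤ × ℤ => (p.1 + p.2 + 1, p.1 - p.2))) := by
    constructor
    · rw [Set.disjoint_left]
      rintro _ ⟨⟨a, b⟩, rfl⟩ ⟨⟨c, d⟩, h⟩
      simp only [Prod.mk.injEq] at h
      omega
    · rw [codisjoint_iff_le_sup]
      rintro ⟨a, b⟩ -
      rcases Int.even_or_odd (a + b) with ⟨k, hk⟩ | ⟨k, hk⟩
      · refine Or.inl ⟨(k, a - k), ?_⟩
        simp only [Prod.mk.injEq]
        omega
      · refine Or.inr ⟨(k, a - 1 - k), ?_⟩
        simp only [Prod.mk.injEq]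
        omega
  exact HasSum.add_isCompl hc (i1.hasSum_range_iff.mpr ha) (i2.hasSum_range_iff.mpr hb)

open Complex in
theorem hasSum_jacobiTheta₂_mul (z w : ℂ) {τ : ℂ} (hτ : 0 < τ.im) :
    HasSum (fun p : ℤ × ℤ => jacobiTheta₂_term p.1 z τ * jacobiTheta₂_term p.2 w τ)
      (jacobiTheta₂ z τ * jacobiTheta₂ w τ) := by
  have hs : Summable (fun p : ℤ × ℤ => jacobiTheta₂_term p.1 z τ * jacobiTheta₂_term p.2 w τ) :=
    summable_mul_of_summable_norm (f := fun n => jacobiTheta₂_term n z τ)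
      (g := fun n => jacobiTheta₂_term n w τ) ((summable_jacobiTheta₂_term_iff z τ).mpr hτ).norm
      ((summable_jacobiTheta₂_term_iff w τ).mpr hτ).norm
  exact HasSum.mul (f := fun n => jacobiTheta₂_term n z τ)
    (g := fun n => jacobiTheta₂_term n w τ) (hasSum_jacobiTheta₂_term z hτ)
    (hasSum_jacobiTheta₂_term w hτ) hs

open Complex in
theorem jacobiTheta₂_mul_jacobiTheta₂ (z w : ℂ) {τ : ℂ} (hτ : 0 < τ.im) :
    jacobiTheta₂ z τ * jacobiTheta₂ w τ =
      jacobiTheta₂ (z + w) (2 * τ) * jacobiTheta₂ (z - w) (2 * τ) +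
      exp (2 * Real.pi * Complex.I * z + Real.pi * Complex.I * τ) *
        (jacobiTheta₂ (z + w + τ) (2 * τ) * jacobiTheta₂ (z - w + τ) (2 * τ)) := by
  have h2 : 0 < (2 * τ).im := by simpa using hτ
  refine (hasSum_jacobiTheta₂_mul z w hτ).unique (Int.hasSum_prod_of_parity ?_ ?_)
  · convert! hasSum_jacobiTheta₂_mul (z + w) (z - w) h2 using 2 with p
    simp only [jacobiTheta₂_term, ← exp_add]
    congr 1
    push_cast
    ring
  · convert! (hasSum_jacobiTheta₂_mul (z + w + τ) (z - w + τ) h2).mul_left _ using 2 with p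
    simp only [jacobiTheta₂_term, ← exp_add]
    congr 1
    push_cast
    ring

/-- The theta constant `θ₄(τ) = ∑_{n ∈ ℤ} (-1)ⁿ q^{n²}`. -/
noncomputable def thetaFour (τ : ℍ) : ℂ := jacobiTheta₂ (1 / 2) τ

open Complex in
theorem thetaTwo_eq (τ : ℍ) :
    thetaTwo τ = exp (Real.pi * Complex.I * τ / 4) * jacobiTheta₂ (τ / 2) τ := by
  rw [← jacobiTheta₂_neg_left, jacobiTheta₂, ← tsum_mul_left, thetaTwo]
  refine tsum_congr fun n => ?_
  rw [jacobiTheta₂_term, ← exp_add]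
  congr 1
  ring

theorem thetaThree_eq (τ : ℍ) : thetaThree τ = jacobiTheta₂ 0 τ :=
  jacobiTheta_eq_jacobiTheta₂ _

/-- The point `2τ` of the upper half plane. -/
noncomputable def UpperHalfPlane.double (τ : ℍ) : ℍ := ⟨2 * τ, by simpa using τ.im_pos⟩

theorem UpperHalfPlane.coe_double (τ : ℍ) : (τ.double : ℂ) = 2 * τ := rfl

open Complex in
theorem thetaThree_sq (τ : ℍ) :
    thetaThree τ ^ 2 = thetaThree τ.double ^ 2 + thetaTwo τ.double ^ 2 := by
  have h := jacobiTheta₂_mul_jacobiTheta₂ 0 0 τ.im_pos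
  have e : exp (Real.pi * Complex.I * τ) = exp (Real.pi * Complex.I * (2 * τ) / 4) ^ 2 := by
    rw [← exp_nat_mul]; congr 1; push_cast; ring
  simp only [mul_zero, add_zero, zero_add, sub_zero] at h
  rw [thetaThree_eq, thetaThree_eq, thetaTwo_eq, UpperHalfPlane.coe_double, sq, h, e]
  ring_nf

open Complex in
theorem thetaFour_sq (τ : ℍ) :
    thetaFour τ ^ 2 = thetaThree τ.double ^ 2 - thetaTwo τ.double ^ 2 := by
  have h := jacobiTheta₂_mul_jacobiTheta₂ (1 / 2) (1 / 2) τ.im_pos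
  have e : exp (2 * Real.pi * Complex.I * (1 / 2) + Real.pi * Complex.I * τ) =
      -exp (Real.pi * Complex.I * (2 * τ) / 4) ^ 2 := by
    rw [← exp_nat_mul, exp_add, show 2 * (Real.pi : ℂ) * Complex.I * (1 / 2) = Real.pi * Complex.I by ring,
      exp_pi_mul_I, neg_one_mul]
    congr 2; push_cast; ring
  have h1 : jacobiTheta₂ 1 (2 * τ) = jacobiTheta₂ 0 (2 * τ) := by
    simpa using jacobiTheta₂_add_left 0 (2 * τ)
  have h3 : jacobiTheta₂ (1 + τ) (2 * τ) = jacobiTheta₂ τ (2 * τ) := by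
    rw [add_comm, jacobiTheta₂_add_left]
  rw [e, add_halves, sub_self, zero_add, h1, h3] at h
  rw [thetaThree_eq, thetaFour, thetaTwo_eq, UpperHalfPlane.coe_double, sq, h,
    show 2 * (τ : ℂ) / 2 = τ by ring]
  ring

open Complex in
theorem thetaTwo_sq (τ : ℍ) :
    thetaTwo τ ^ 2 = 2 * thetaTwo τ.double * thetaThree τ.double := by
  have h := jacobiTheta₂_mul_jacobiTheta₂ (τ / 2) (τ / 2) τ.im_pos
  have h1 := jacobiTheta₂_add_left' 0 (2 * τ)
  rw [zero_add] at h1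
  rw [add_halves, sub_self, zero_add, ← two_mul, h1] at h
  have e : exp (2 * Real.pi * Complex.I * (τ / 2) + Real.pi * Complex.I * τ) *
      exp (-Real.pi * Complex.I * (2 * τ + 2 * 0)) = 1 := by
    rw [← exp_add, exp_eq_one_iff]
    exact ⟨0, by push_cast; ring⟩
  have e2 : exp (Real.pi * Complex.I * τ / 4) ^ 2 = exp (Real.pi * Complex.I * (2 * τ) / 4) := by
    rw [← exp_nat_mul]; congr 1; push_cast; ring
  rw [thetaThree_eq, thetaTwo_eq, thetaTwo_eq, UpperHalfPlane.coe_double, mul_pow, e2, sq, h,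
    show 2 * (τ : ℂ) / 2 = τ by ring]
  linear_combination exp (Real.pi * Complex.I * (2 * τ) / 4) * jacobiTheta₂ 0 (2 * τ) *
    jacobiTheta₂ τ (2 * τ) * e

/-- **Jacobi's identity** for theta constants. -/
theorem thetaThree_pow_four (τ : ℍ) : thetaThree τ ^ 4 = thetaTwo τ ^ 4 + thetaFour τ ^ 4 := by
  have h3 := thetaThree_sq τ
  have h4 := thetaFour_sq τ
  have h2 := thetaTwo_sq τ
  -- With a = θ₃(2τ), b = θ₂(2τ) this is (a² + b²)² = (2ab)² + (a² - b²)².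
  rw [show thetaThree τ ^ 4 = (thetaThree τ ^ 2) ^ 2 by ring,
    show thetaFour τ ^ 4 = (thetaFour τ ^ 2) ^ 2 by ring,
    show thetaTwo τ ^ 4 = (thetaTwo τ ^ 2) ^ 2 by ring, h2, h3, h4]
  ring

theorem thetaThree_mul_thetaFour_sq (τ : ℍ) :
    (thetaThree τ * thetaFour τ) ^ 2 = thetaFour τ.double ^ 4 := by
  rw [mul_pow, thetaThree_sq, thetaFour_sq]
  linear_combination thetaThree_pow_four τ.double

/-! ### The translation T and non-vanishing of the theta constants -/

open Complex in
theorem jacobiTheta₂_add_one_right (z τ : ℂ) :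
    jacobiTheta₂ z (τ + 1) = jacobiTheta₂ (z + 1 / 2) τ := by
  refine tsum_congr fun n => ?_
  simp only [jacobiTheta₂_term]
  -- n² and n differ by the even number (n - 1)n, so exp(πi n²) = exp(πi n).
  obtain ⟨k, hk⟩ := Int.even_mul_succ_self (n - 1)
  rw [exp_eq_exp_iff_exists_int]
  refine ⟨k, ?_⟩
  have hk' : ((n : ℂ) - 1) * n = k + k := by exact_mod_cast (by linarith : (n - 1) * n = k + k)
  linear_combination Real.pi * Complex.I * hk'

theorem tendsto_thetaThree_atImInfty : Filter.Tendsto thetaThree atImInfty (nhds 1) := by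
  have h : Filter.Tendsto (fun τ : ℍ => jacobiTheta τ - 1) atImInfty (nhds 0) := by
    refine (isBigO_at_im_infty_jacobiTheta_sub_one.comp_tendsto
      tendsto_coe_atImInfty).trans_tendsto ?_
    refine Real.tendsto_exp_atBot.comp ?_
    refine Filter.Tendsto.const_mul_atTop_of_neg (neg_lt_zero.mpr Real.pi_pos) ?_
    exact Filter.tendsto_comap
  have h1 := h.add_const 1
  simp only [sub_add_cancel, zero_add] at h1
  exact h1

theorem thetaThree_T_smul (τ : ℍ) : thetaThree (ModularGroup.T • τ) = thetaFour τ := by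
  rw [thetaThree_eq, thetaFour, modular_T_smul, coe_vadd, add_comm, Complex.ofReal_one,
    jacobiTheta₂_add_one_right, zero_add]

theorem thetaFour_T_smul (τ : ℍ) : thetaFour (ModularGroup.T • τ) = thetaThree τ := by
  rw [thetaThree_eq, thetaFour, modular_T_smul, coe_vadd, add_comm, Complex.ofReal_one,
    jacobiTheta₂_add_one_right, add_halves]
  simpa using jacobiTheta₂_add_left 0 τ

open Complex in
-- T exchanges θ₃ and θ₄, so Jacobi's identity at τ and at Tτ forces the sign.
theorem thetaTwo_T_smul_pow_four (τ : ℍ) :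
    thetaTwo (ModularGroup.T • τ) ^ 4 = -thetaTwo τ ^ 4 := by
  have h1 := thetaThree_pow_four τ
  have h2 := thetaThree_pow_four (ModularGroup.T • τ)
  rw [thetaThree_T_smul, thetaFour_T_smul] at h2
  linear_combination -h1 - h2

theorem tendsto_T_smul_atImInfty :
    Filter.Tendsto (fun τ : ℍ => ModularGroup.T • τ) atImInfty atImInfty := by
  simp only [atImInfty, Filter.tendsto_comap_iff, Function.comp_def, ModularGroup.im_T_smul]
  exact Filter.tendsto_comap

theorem tendsto_thetaFour_atImInfty : Filter.Tendsto thetaFour atImInfty (nhds 1) := by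
  have h := tendsto_thetaThree_atImInfty.comp tendsto_T_smul_atImInfty
  simp only [Function.comp_def, thetaThree_T_smul] at h
  exact h

/-- By `thetaThree_mul_thetaFour_sq` a zero at τ propagates to 2τ, 4τ, …, which tend to i∞, where θ₄
→ 1. -/
theorem thetaFour_ne_zero (τ : ℍ) : thetaFour τ ≠ 0 := by
  intro h0
  have h : ∀ n : ℕ, thetaFour (UpperHalfPlane.double^[n] τ) = 0 := by
    intro n
    induction n with
    | zero => exact h0
    | succ n ih =>
      rw [Function.iterate_succ_apply']
      have := thetaThree_mul_thetaFour_sq (UpperHalfPlane.double^[n] τ)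
      rw [ih] at this
      simpa using this.symm
  have him : ∀ n : ℕ, (UpperHalfPlane.double^[n] τ).im = 2 ^ n * τ.im := by
    intro n
    induction n with
    | zero => simp
    | succ n ih =>
      rw [Function.iterate_succ_apply', pow_succ', mul_assoc, ← ih]
      rw [← coe_im, coe_double, ← coe_im]
      simp
  have ht : Filter.Tendsto (fun n : ℕ => UpperHalfPlane.double^[n] τ) Filter.atTop atImInfty := by
    simp only [atImInfty, Filter.tendsto_comap_iff, Function.comp_def, him]
    exact (tendsto_pow_atTop_atTop_of_one_lt one_lt_two).atTop_mul_const τ.im_pos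
  have := tendsto_thetaFour_atImInfty.comp ht
  simp only [Function.comp_def, h] at this
  exact zero_ne_one (tendsto_nhds_unique tendsto_const_nhds this)

theorem thetaThree_ne_zero (τ : ℍ) : thetaThree τ ≠ 0 := by
  rw [← thetaFour_T_smul]
  exact thetaFour_ne_zero _

/-! ### The inversion S and the generators acting on λ -/

theorem UpperHalfPlane.coe_S_smul (τ : ℍ) : ((ModularGroup.S • τ : ℍ) : ℂ) = -1 / τ := by
  rw [modular_S_smul, neg_div, one_div, ← inv_neg]

open Complex in
theorem thetaThree_eq_S_smul (τ : ℍ) :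
    thetaThree τ = 1 / (-Complex.I * τ) ^ (1 / 2 : ℂ) * thetaThree (ModularGroup.S • τ) := by
  rw [thetaThree_eq, thetaThree_eq, coe_S_smul, jacobiTheta₂_functional_equation]
  simp

open Complex in
theorem thetaFour_eq_S_smul (τ : ℍ) :
    thetaFour τ = 1 / (-Complex.I * τ) ^ (1 / 2 : ℂ) * thetaTwo (ModularGroup.S • τ) := by
  rw [thetaFour, thetaTwo_eq, coe_S_smul, jacobiTheta₂_functional_equation, mul_assoc]
  congr 1
  have h0 : (τ : ℂ) ≠ 0 := τ.ne_zero
  rw [← jacobiTheta₂_neg_left]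
  congr 2
  · field_simp
    norm_num
  · field_simp

theorem S_smul_S_smul (τ : ℍ) : ModularGroup.S • ModularGroup.S • τ = τ := by
  have h0 : (τ : ℂ) ≠ 0 := τ.ne_zero
  ext
  rw [coe_S_smul, coe_S_smul]
  field_simp

theorem thetaTwo_ne_zero (τ : ℍ) : thetaTwo τ ≠ 0 := by
  intro h
  have := thetaFour_eq_S_smul (ModularGroup.S • τ)
  rw [S_smul_S_smul, h, mul_zero] at this
  exact thetaFour_ne_zero _ this

theorem lambdaFun_ne_zero (τ : ℍ) : lambdaFun τ ≠ 0 :=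
  pow_ne_zero _ (div_ne_zero (thetaTwo_ne_zero τ) (thetaThree_ne_zero τ))

theorem one_sub_lambdaFun (τ : ℍ) : 1 - lambdaFun τ = (thetaFour τ / thetaThree τ) ^ 4 := by
  have := thetaThree_ne_zero τ
  rw [lambdaFun, div_pow, div_pow]
  field_simp
  linear_combination thetaThree_pow_four τ

theorem lambdaFun_ne_one (τ : ℍ) : lambdaFun τ ≠ 1 := by
  intro h
  have := one_sub_lambdaFun τ
  rw [h, sub_self] at this
  exact pow_ne_zero 4 (div_ne_zero (thetaFour_ne_zero τ) (thetaThree_ne_zero τ)) this.symm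

theorem lambdaFun_S_smul (τ : ℍ) : lambdaFun (ModularGroup.S • τ) = 1 - lambdaFun τ := by
  have h0 := thetaFour_ne_zero τ
  rw [one_sub_lambdaFun, lambdaFun]
  rw [thetaFour_eq_S_smul] at h0 ⊢
  rw [thetaThree_eq_S_smul τ, mul_div_mul_left]
  exact left_ne_zero_of_mul h0

theorem lambdaFun_T_smul (τ : ℍ) :
    lambdaFun (ModularGroup.T • τ) = lambdaFun τ / (lambdaFun τ - 1) := by
  have h3 := thetaThree_ne_zero τ
  have h4 := thetaFour_ne_zero τ
  rw [← neg_sub 1 (lambdaFun τ), one_sub_lambdaFun, lambdaFun, div_pow, thetaTwo_T_smul_pow_four,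
    thetaThree_T_smul, lambdaFun, div_pow, div_pow]
  field_simp

theorem S_smul_I : ModularGroup.S • UpperHalfPlane.I = UpperHalfPlane.I := by
  ext
  rw [coe_S_smul]
  simp

theorem lambdaFun_I : lambdaFun UpperHalfPlane.I = 1 / 2 := by
  have := lambdaFun_S_smul UpperHalfPlane.I
  rw [S_smul_I] at this
  linear_combination this / 2

theorem lambdaFun_T_inv_smul (τ : ℍ) :
    lambdaFun (ModularGroup.T⁻¹ • τ) = lambdaFun τ / (lambdaFun τ - 1) := by
  have h := lambdaFun_T_smul (ModularGroup.T⁻¹ • τ)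
  rw [smul_inv_smul] at h
  have h1 := sub_ne_zero.mpr (lambdaFun_ne_one (ModularGroup.T⁻¹ • τ))
  have h2 := sub_ne_zero.mpr (lambdaFun_ne_one τ)
  rw [eq_div_iff h1] at h
  rw [eq_div_iff h2]
  linear_combination h

theorem lambdaFun_S_inv_smul (τ : ℍ) : lambdaFun (ModularGroup.S⁻¹ • τ) = 1 - lambdaFun τ := by
  have h := lambdaFun_S_smul (ModularGroup.S⁻¹ • τ)
  rw [smul_inv_smul] at h
  linear_combination h

/-! ### The anharmonic action of SL(2, ℤ) on λ -/

theorem anharmonic_one_sub {x : ℂ} (h0 : x ≠ 0) (h1 : x ≠ 1) :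
    1 - (1 - x) = x ∧ (1 - x) / (1 - x - 1) = (x - 1) / x ∧ 1 / (1 - (1 - x)) = 1 / x ∧
      (1 - x - 1) / (1 - x) = x / (x - 1) := by
  have h1' : x - 1 ≠ 0 := sub_ne_zero.mpr h1
  have h2 : 1 - x ≠ 0 := sub_ne_zero.mpr h1.symm
  refine ⟨by ring, ?_, by ring_nf, ?_⟩
  · rw [show 1 - x - 1 = -x by ring]
    field_simp
    ring
  · field_simp
    ring

theorem anharmonic_div_sub_one {x : ℂ} (h0 : x ≠ 0) (h1 : x ≠ 1) :
    1 - x / (x - 1) = 1 / (1 - x) ∧ x / (x - 1) / (x / (x - 1) - 1) = x ∧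
      1 / (1 - x / (x - 1)) = 1 - x ∧ (x / (x - 1) - 1) / (x / (x - 1)) = 1 / x ∧
      1 / (x / (x - 1)) = (x - 1) / x := by
  have h1' : x - 1 ≠ 0 := sub_ne_zero.mpr h1
  have h2 : 1 - x ≠ 0 := sub_ne_zero.mpr h1.symm
  have e : x / (x - 1) - 1 = 1 / (x - 1) := by
    field_simp
    ring
  have e' : 1 - x / (x - 1) = 1 / (1 - x) := by
    rw [← neg_sub, e]
    field_simp
    ring
  rw [e, e']
  refine ⟨rfl, ?_, ?_, ?_, ?_⟩ <;> field_simp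

/-- The six anharmonic transforms of `λ`, indexed by the reduction of the matrix modulo `2`. -/
theorem lambdaFun_smul (g : SL(2, ℤ)) :
    ((g 0 0 : ZMod 2) = 1 ∧ (g 0 1 : ZMod 2) = 0 ∧ (g 1 0 : ZMod 2) = 0 ∧ (g 1 1 : ZMod 2) = 1 ∧
      ∀ τ, lambdaFun (g • τ) = lambdaFun τ) ∨
    ((g 0 0 : ZMod 2) = 0 ∧ (g 0 1 : ZMod 2) = 1 ∧ (g 1 0 : ZMod 2) = 1 ∧ (g 1 1 : ZMod 2) = 0 ∧
      ∀ τ, lambdaFun (g • τ) = 1 - lambdaFun τ) ∨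
    ((g 0 0 : ZMod 2) = 1 ∧ (g 0 1 : ZMod 2) = 1 ∧ (g 1 0 : ZMod 2) = 0 ∧ (g 1 1 : ZMod 2) = 1 ∧
      ∀ τ, lambdaFun (g • τ) = lambdaFun τ / (lambdaFun τ - 1)) ∨
    ((g 0 0 : ZMod 2) = 0 ∧ (g 0 1 : ZMod 2) = 1 ∧ (g 1 0 : ZMod 2) = 1 ∧ (g 1 1 : ZMod 2) = 1 ∧
      ∀ τ, lambdaFun (g • τ) = 1 / (1 - lambdaFun τ)) ∨
    ((g 0 0 : ZMod 2) = 1 ∧ (g 0 1 : ZMod 2) = 1 ∧ (g 1 0 : ZMod 2) = 1 ∧ (g 1 1 : ZMod 2) = 0 ∧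
      ∀ τ, lambdaFun (g • τ) = (lambdaFun τ - 1) / lambdaFun τ) ∨
    ((g 0 0 : ZMod 2) = 1 ∧ (g 0 1 : ZMod 2) = 0 ∧ (g 1 0 : ZMod 2) = 1 ∧ (g 1 1 : ZMod 2) = 1 ∧
      ∀ τ, lambdaFun (g • τ) = 1 / lambdaFun τ) := by
  have two : (1 : ZMod 2) + 1 = 0 := by decide
  have negone : (-1 : ZMod 2) = 1 := by decide
  have hs τ := anharmonic_one_sub (lambdaFun_ne_zero τ) (lambdaFun_ne_one τ)
  have ht τ := anharmonic_div_sub_one (lambdaFun_ne_zero τ) (lambdaFun_ne_one τ)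
  have hS : ∀ g : SL(2, ℤ), (g * ModularGroup.S) 0 0 = g 0 1 ∧ (g * ModularGroup.S) 0 1 = -g 0 0 ∧
      (g * ModularGroup.S) 1 0 = g 1 1 ∧ (g * ModularGroup.S) 1 1 = -g 1 0 := by
    intro g
    simp [ModularGroup.coe_S, Matrix.mul_apply, Fin.sum_univ_two]
  have hSi : ∀ g : SL(2, ℤ), (g * ModularGroup.S⁻¹) 0 0 = -g 0 1 ∧
      (g * ModularGroup.S⁻¹) 0 1 = g 0 0 ∧
      (g * ModularGroup.S⁻¹) 1 0 = -g 1 1 ∧ (g * ModularGroup.S⁻¹) 1 1 = g 1 0 := by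
    intro g
    simp [ModularGroup.coe_S, Matrix.mul_apply, Fin.sum_univ_two, Matrix.adjugate_fin_two]
  have hT : ∀ g : SL(2, ℤ), (g * ModularGroup.T) 0 0 = g 0 0 ∧
      (g * ModularGroup.T) 0 1 = g 0 0 + g 0 1 ∧
      (g * ModularGroup.T) 1 0 = g 1 0 ∧ (g * ModularGroup.T) 1 1 = g 1 0 + g 1 1 := by
    intro g
    simp [ModularGroup.coe_T, Matrix.mul_apply, Fin.sum_univ_two]
  have hTi : ∀ g : SL(2, ℤ), (g * ModularGroup.T⁻¹) 0 0 = g 0 0 ∧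
      (g * ModularGroup.T⁻¹) 0 1 = -g 0 0 + g 0 1 ∧
      (g * ModularGroup.T⁻¹) 1 0 = g 1 0 ∧ (g * ModularGroup.T⁻¹) 1 1 = -g 1 0 + g 1 1 := by
    intro g
    simp [Matrix.mul_apply, Fin.sum_univ_two]
  -- The induction multiplies on the right: λ(xyτ) is then the known transform for x evaluated at
  -- λ(yτ), with y a generator or its inverse.
  have hg : g ∈ Subgroup.closure {ModularGroup.S, ModularGroup.T} := by
    simp [SpecialLinearGroup.SL2Z_generators]
  induction hg using Subgroup.closure_induction_right with
  | one => left; simp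
  | mul_right x y hx hy ih =>
    rcases hy with rfl | rfl
    · obtain ⟨e1, e2, e3, e4⟩ := hS x
      simp only [e1, e2, e3, e4, Int.cast_neg, mul_smul]
      -- The entries modulo 2 select one of the six alternatives; what remains is an anharmonic
      -- identity from `hs` or `ht`.
      rcases ih with ⟨a, b, c, d, h⟩ | ⟨a, b, c, d, h⟩ | ⟨a, b, c, d, h⟩ | ⟨a, b, c, d, h⟩ |
        ⟨a, b, c, d, h⟩ | ⟨a, b, c, d, h⟩ <;>
        simp only [a, b, c, d, h, lambdaFun_S_smul, negone, neg_zero, zero_ne_one, one_ne_zero,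
          false_and, and_false, false_or, or_false, true_and] <;> intro τ <;>
        obtain ⟨s1, s2, s3, s4⟩ := hs τ <;> obtain ⟨t1, t2, t3, t4, t5⟩ := ht τ <;>
        trivial
    · obtain ⟨e1, e2, e3, e4⟩ := hT x
      simp only [e1, e2, e3, e4, Int.cast_add, mul_smul]
      rcases ih with ⟨a, b, c, d, h⟩ | ⟨a, b, c, d, h⟩ | ⟨a, b, c, d, h⟩ | ⟨a, b, c, d, h⟩ |
        ⟨a, b, c, d, h⟩ | ⟨a, b, c, d, h⟩ <;>
        simp only [a, b, c, d, h, lambdaFun_T_smul, two, add_zero, zero_add, zero_ne_one,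
          one_ne_zero, false_and, and_false, false_or, or_false, true_and] <;> intro τ <;>
        obtain ⟨s1, s2, s3, s4⟩ := hs τ <;> obtain ⟨t1, t2, t3, t4, t5⟩ := ht τ <;>
        trivial
  | mul_inv_cancel x y hx hy ih =>
    rcases hy with rfl | rfl
    · obtain ⟨e1, e2, e3, e4⟩ := hSi x
      simp only [e1, e2, e3, e4, Int.cast_neg, mul_smul]
      rcases ih with ⟨a, b, c, d, h⟩ | ⟨a, b, c, d, h⟩ | ⟨a, b, c, d, h⟩ | ⟨a, b, c, d, h⟩ |
        ⟨a, b, c, d, h⟩ | ⟨a, b, c, d, h⟩ <;>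
        simp only [a, b, c, d, h, lambdaFun_S_inv_smul, negone, neg_zero, zero_ne_one, one_ne_zero,
          false_and, and_false, false_or, or_false, true_and] <;> intro τ <;>
        obtain ⟨s1, s2, s3, s4⟩ := hs τ <;> obtain ⟨t1, t2, t3, t4, t5⟩ := ht τ <;>
        trivial
    · obtain ⟨e1, e2, e3, e4⟩ := hTi x
      simp only [e1, e2, e3, e4, Int.cast_add, Int.cast_neg, mul_smul]
      rcases ih with ⟨a, b, c, d, h⟩ | ⟨a, b, c, d, h⟩ | ⟨a, b, c, d, h⟩ | ⟨a, b, c, d, h⟩ |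
        ⟨a, b, c, d, h⟩ | ⟨a, b, c, d, h⟩ <;>
        simp only [a, b, c, d, h, lambdaFun_T_inv_smul, negone, neg_zero, two, add_zero, zero_add,
          zero_ne_one, one_ne_zero, false_and, and_false, false_or, or_false, true_and] <;> intro τ <;>
        obtain ⟨s1, s2, s3, s4⟩ := hs τ <;> obtain ⟨t1, t2, t3, t4, t5⟩ := ht τ <;>
        trivial

theorem lambdaFun_smul_of_mem_Gamma_two {γ : SL(2, ℤ)} (hγ : γ ∈ CongruenceSubgroup.Gamma 2)
    (τ : ℍ) : lambdaFun (γ • τ) = lambdaFun τ := by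
  rw [CongruenceSubgroup.Gamma_mem] at hγ
  obtain ⟨a, b, c, d⟩ := hγ
  have h := lambdaFun_smul γ
  simp only [a, b, c, d, zero_ne_one, one_ne_zero, false_and, and_false, or_false, true_and] at h
  exact h τ

/-! ### Behaviour of λ at the cusps -/

open Complex Filter in
-- The n-th term has norm exp(-π n(n + 1) Im τ), so only n = 0 and n = -1 survive, each equal to 1.
-- For Im τ ≥ 1 the terms at τ = i dominate.
theorem tendsto_jacobiTheta₂_half_atImInfty :
    Tendsto (fun τ : ℍ => jacobiTheta₂ (τ / 2) τ) atImInfty (nhds 2) := by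
  have hn : ∀ (n : ℤ) (τ : ℍ), ‖jacobiTheta₂_term n (τ / 2) τ‖ =
      Real.exp (-(Real.pi * (n * (n + 1))) * τ.im) := by
    intro n τ
    rw [norm_jacobiTheta₂_term]
    congr 1
    have : ((τ : ℂ) / 2).im = τ.im / 2 := by
      rw [← coe_im]
      simp
    rw [this, coe_im]
    ring
  have hpos : ∀ n : ℤ, (0 : ℝ) ≤ n * (n + 1) := by
    intro n
    have : 0 ≤ n * (n + 1) := by
      rcases le_or_gt 0 n with h | h
      · positivity
      · exact mul_nonneg_of_nonpos_of_nonpos h.le (by omega)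
    exact_mod_cast this
  have key : Tendsto (fun τ : ℍ => ∑' n : ℤ, jacobiTheta₂_term n (τ / 2) τ) atImInfty
      (nhds (∑' n : ℤ, if n ∈ ({0, -1} : Finset ℤ) then 1 else 0)) := by
    refine tendsto_tsum_of_dominated_convergence
      (bound := fun n => ‖jacobiTheta₂_term n (UpperHalfPlane.I / 2) UpperHalfPlane.I‖)
      ((summable_jacobiTheta₂_term_iff _ _).mpr UpperHalfPlane.I.im_pos).norm ?_ ?_
    · intro n
      by_cases h : n ∈ ({0, -1} : Finset ℤ)
      · rw [if_pos h]
        refine tendsto_const_nhds.congr fun τ => ?_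
        simp only [Finset.mem_insert, Finset.mem_singleton] at h
        rcases h with rfl | rfl
        · simp [jacobiTheta₂_term]
        · rw [jacobiTheta₂_term, eq_comm, exp_eq_one_iff]
          exact ⟨0, by push_cast; ring⟩
      · rw [if_neg h, tendsto_zero_iff_norm_tendsto_zero]
        simp only [hn]
        have : 0 < (n : ℝ) * (n + 1) := by
          refine lt_of_le_of_ne (hpos n) fun h0 => h ?_
          have h0' : n * (n + 1) = 0 := by exact_mod_cast h0.symm
          simp only [Finset.mem_insert, Finset.mem_singleton]
          rcases mul_eq_zero.mp h0' with h | h <;> omega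
        refine Real.tendsto_exp_atBot.comp ?_
        exact tendsto_comap.const_mul_atTop_of_neg
          (neg_lt_zero.mpr (mul_pos Real.pi_pos this))
    · filter_upwards [(atImInfty_mem {τ : ℍ | 1 ≤ τ.im}).mpr ⟨1, fun z hz => hz⟩] with τ hτ n
      rw [hn, hn, Real.exp_le_exp, UpperHalfPlane.I_im, neg_mul, neg_mul, neg_le_neg_iff]
      exact mul_le_mul_of_nonneg_left hτ (mul_nonneg Real.pi_pos.le (hpos n))
  have hs : (∑' n : ℤ, if n ∈ ({0, -1} : Finset ℤ) then (1 : ℂ) else 0) = 2 := by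
    rw [tsum_eq_sum (s := {0, -1}) (fun b hb => if_neg hb)]
    rw [Finset.sum_ite_mem, Finset.inter_self, Finset.sum_const]
    simp
  rw [hs] at key
  exact key

open Complex Filter in
theorem tendsto_lambdaFun_mul_exp_atImInfty :
    Tendsto (fun τ : ℍ => lambdaFun τ * exp (-(Real.pi * Complex.I * τ))) atImInfty (nhds 16) := by
  have h := (tendsto_jacobiTheta₂_half_atImInfty.div tendsto_thetaThree_atImInfty
    one_ne_zero).pow 4
  norm_num at h
  refine h.congr fun τ => ?_
  have h3 := thetaThree_ne_zero τ
  have e : exp (Real.pi * Complex.I * τ / 4) ^ 4 * exp (-(Real.pi * Complex.I * τ)) = 1 := by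
    rw [← exp_nat_mul, ← exp_add, exp_eq_one_iff]
    exact ⟨0, by push_cast; ring⟩
  rw [lambdaFun, thetaTwo_eq, div_pow, div_pow, mul_pow]
  linear_combination -(jacobiTheta₂ (τ / 2) τ ^ 4 / thetaThree τ ^ 4) * e

open Complex Filter in
theorem tendsto_lambdaFun_atImInfty : Tendsto lambdaFun atImInfty (nhds 0) := by
  have h : Tendsto (fun τ : ℍ => exp (Real.pi * Complex.I * τ)) atImInfty (nhds 0) := by
    rw [tendsto_zero_iff_norm_tendsto_zero]
    have : ∀ τ : ℍ, ‖exp (Real.pi * Complex.I * τ)‖ = Real.exp (-Real.pi * τ.im) := by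
      intro τ
      rw [norm_exp]
      simp
    simp only [this]
    exact Real.tendsto_exp_atBot.comp
      (tendsto_comap.const_mul_atTop_of_neg (neg_lt_zero.mpr Real.pi_pos))
  have := tendsto_lambdaFun_mul_exp_atImInfty.mul h
  rw [mul_zero] at this
  refine this.congr fun τ => ?_
  rw [mul_assoc, ← exp_add, neg_add_cancel, exp_zero, mul_one]

open Complex Filter in
/-- At every cusp `λ` has at most exponential growth. -/
theorem exists_norm_lambdaFun_smul_le (g : SL(2, ℤ)) :
    ∃ C : ℝ, ∀ᶠ τ in atImInfty, ‖lambdaFun (g • τ)‖ ≤ C * Real.exp (Real.pi * τ.im) := by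
  have hb : ∀ᶠ τ in atImInfty, ‖lambdaFun τ‖ ≤ 1 / 2 :=
    (tendsto_lambdaFun_atImInfty.norm).eventually_le_const (by norm_num)
  have hd : ∀ᶠ τ in atImInfty, 1 ≤ ‖lambdaFun τ‖ * Real.exp (Real.pi * τ.im) := by
    filter_upwards [tendsto_lambdaFun_mul_exp_atImInfty.norm.eventually_const_le
      (u := 1) (by norm_num)] with τ hτ
    rw [norm_mul, norm_exp] at hτ
    simpa using hτ
  -- With E = exp(π Im τ), the bounds |λ| ≤ 1/2 and 1 ≤ |λ|E keep all six transforms below max(2,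
  -- 3E/2), so 3 leaves room.
  refine ⟨3, ?_⟩
  filter_upwards [hb, hd] with τ h1 h2
  have e1 : 1 ≤ Real.exp (Real.pi * τ.im) :=
    Real.one_le_exp (mul_nonneg Real.pi_pos.le τ.im_pos.le)
  set E := Real.exp (Real.pi * τ.im)
  have hl : 1 / 2 ≤ ‖1 - lambdaFun τ‖ := by
    have := norm_sub_norm_le (1 : ℂ) (lambdaFun τ)
    rw [norm_one] at this
    linarith
  have hu : ‖1 - lambdaFun τ‖ ≤ 3 / 2 := by
    have := norm_sub_le (1 : ℂ) (lambdaFun τ)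
    rw [norm_one] at this
    linarith
  have hp : 0 < ‖lambdaFun τ‖ := norm_pos_iff.mpr (lambdaFun_ne_zero τ)
  rcases lambdaFun_smul g with h | h | h | h | h | h <;>
    obtain ⟨-, -, -, -, h⟩ := h <;> rw [h]
  · linarith
  · linarith
  · rw [norm_div, norm_sub_rev, div_le_iff₀ (by linarith)]
    nlinarith
  · rw [norm_div, norm_one, div_le_iff₀ (by linarith)]
    nlinarith
  · rw [norm_div, norm_sub_rev, div_le_iff₀ hp]
    nlinarith
  · rw [norm_div, norm_one, div_le_iff₀ hp]
    nlinarith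

/-! ### Holomorphy of λ and its reflection symmetry -/

open Complex in
theorem differentiableAt_lambdaFun (τ : ℍ) :
    DifferentiableAt ℂ (fun z : ℂ => lambdaFun (ofComplex z)) τ := by
  have h2 : DifferentiableAt ℂ
      (fun z : ℂ => exp (Real.pi * Complex.I * z / 4) * jacobiTheta₂ (z / 2) z) τ := by
    have h := (hasFDerivAt_jacobiTheta₂ (τ / 2) τ.im_pos).differentiableAt
    have h' : DifferentiableAt ℂ (fun z : ℂ => (z / 2, z)) τ := by fun_prop
    have := DifferentiableAt.comp (g := fun p : ℂ × ℂ => jacobiTheta₂ p.1 p.2)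
      (f := fun z : ℂ => (z / 2, z)) (τ : ℂ) h h'
    exact DifferentiableAt.mul (by fun_prop) this
  have h3 := differentiableAt_jacobiTheta₂_snd 0 τ.im_pos
  have h3n : jacobiTheta₂ 0 τ ≠ 0 := by
    rw [← thetaThree_eq]
    exact thetaThree_ne_zero τ
  refine ((h2.div h3 h3n).pow 4).congr_of_eventuallyEq ?_
  filter_upwards [isOpen_upperHalfPlaneSet.mem_nhds τ.im_pos] with z hz
  simp only [lambdaFun, thetaTwo_eq, thetaThree_eq, ofComplex_apply_of_im_pos hz]
  rfl

theorem continuous_lambdaFun : Continuous lambdaFun := by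
  rw [continuous_iff_continuousAt]
  intro τ
  have h := (differentiableAt_lambdaFun τ).continuousAt.comp continuous_coe.continuousAt
  simpa [Function.comp_def] using h

/-- The reflection `τ ↦ -τ̄` of the upper half plane. -/
noncomputable def UpperHalfPlane.reflect (τ : ℍ) : ℍ :=
  ⟨-(starRingEnd ℂ) τ, by simpa using τ.im_pos⟩

theorem UpperHalfPlane.coe_reflect (τ : ℍ) : (τ.reflect : ℂ) = -(starRingEnd ℂ) τ := rfl

theorem UpperHalfPlane.continuous_reflect : Continuous UpperHalfPlane.reflect :=
  Continuous.upperHalfPlaneMk (by fun_prop) _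

theorem lambdaFun_reflect (τ : ℍ) : lambdaFun τ.reflect = (starRingEnd ℂ) (lambdaFun τ) := by
  rw [lambdaFun, lambdaFun, thetaTwo_eq, thetaTwo_eq, thetaThree_eq, thetaThree_eq, map_pow,
    map_div₀, map_mul, jacobiTheta₂_conj, jacobiTheta₂_conj, map_zero, ← Complex.exp_conj,
    coe_reflect, ← jacobiTheta₂_neg_left]
  simp [neg_div, Complex.conj_ofNat]

/-! ### Belyi maps P/Q as coverings, and lifting through them -/

theorem Polynomial.exists_norm_eval_le_pow (p : Polynomial ℂ) {m : ℕ} (hm : p.natDegree ≤ m) :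
    ∃ B : ℝ, 0 ≤ B ∧ ∀ x : ℂ, 1 ≤ ‖x‖ → ‖p.eval x‖ ≤ B * ‖x‖ ^ m := by
  refine ⟨∑ i ∈ Finset.range (m + 1), ‖p.coeff i‖,
    Finset.sum_nonneg fun i _ => norm_nonneg _, fun x hx => ?_⟩
  rw [Polynomial.eval_eq_sum_range' (Nat.lt_succ_of_le hm), Finset.sum_mul]
  refine norm_sum_le_of_le _ fun i hi => ?_
  rw [norm_mul, norm_pow]
  exact mul_le_mul_of_nonneg_left
    (pow_le_pow_right₀ hx (Nat.le_of_lt_succ (Finset.mem_range.mp hi))) (norm_nonneg _)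

/-- Two polynomials `P`, `Q` such that `P / Q` is a Belyi map sending `∞` to `∞`: they have no
common zero, `deg Q < deg P`, and the finite critical values of `P / Q` are `0` and `1`. -/
structure Polynomial.IsBelyiPair (P Q : Polynomial ℂ) : Prop where
  natDegree_lt : Q.natDegree < P.natDegree
  ne_zero : ∀ z, P.eval z = 0 → Q.eval z ≠ 0
  critical : ∀ z, (P.derivative * Q - P * Q.derivative).eval z = 0 →
    P.eval z = 0 ∨ P.eval z = Q.eval z

namespace Polynomial.IsBelyiPair

variable {P Q : Polynomial ℂ} (h : IsBelyiPair P Q)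

include h in
-- For |x| > 1 the leading term of P is balanced by terms of degree below deg P. The bound yields
-- properness of P/Q and passes growth of λ on to its lifts.
theorem exists_norm_le : ∃ C : ℝ, 0 ≤ C ∧
    ∀ x y : ℂ, P.eval x = y * Q.eval x → ‖x‖ ≤ C * (1 + ‖y‖) := by
  obtain ⟨n, hn⟩ := Nat.exists_eq_add_of_lt h.natDegree_lt
  set m := Q.natDegree + n with hm
  have hP0 : P ≠ 0 := fun h0 => by simp [h0] at hn
  have hdeg : P.eraseLead.natDegree ≤ m := by
    have := P.eraseLead_natDegree_le
    omega
  obtain ⟨B, hB, hB'⟩ := P.eraseLead.exists_norm_eval_le_pow hdeg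
  obtain ⟨D, hD, hD'⟩ := Q.exists_norm_eval_le_pow (m := m) (by omega)
  have ha : 0 < ‖P.leadingCoeff‖ := norm_pos_iff.mpr (leadingCoeff_ne_zero.mpr hP0)
  refine ⟨1 + (B + D) / ‖P.leadingCoeff‖, by positivity, fun x y hxy => ?_⟩
  rcases le_or_gt ‖x‖ 1 with hx | hx
  · refine hx.trans ?_
    have : 0 ≤ (B + D) / ‖P.leadingCoeff‖ := by positivity
    nlinarith [norm_nonneg y]
  have hsum : P.leadingCoeff * x ^ (m + 1) = y * Q.eval x - P.eraseLead.eval x := by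
    have := congrArg (Polynomial.eval x) P.eraseLead_add_C_mul_X_pow
    rw [hn] at this
    simp only [eval_add, eval_mul, eval_C, eval_pow, eval_X] at this
    rw [← hxy, ← this]
    ring
  have hle : ‖P.leadingCoeff‖ * ‖x‖ ^ (m + 1) ≤ ‖y‖ * (D * ‖x‖ ^ m) + B * ‖x‖ ^ m := by
    rw [← norm_pow, ← norm_mul, hsum]
    refine (norm_sub_le _ _).trans ?_
    rw [norm_mul]
    gcongr
    exacts [hD' x hx.le, hB' x hx.le]
  have hpos : 0 < ‖x‖ ^ m := by positivity
  have hle' : ‖P.leadingCoeff‖ * ‖x‖ ≤ ‖y‖ * D + B := by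
    rw [pow_succ] at hle
    refine le_of_mul_le_mul_right ?_ hpos
    linarith
  calc ‖x‖ ≤ (‖y‖ * D + B) / ‖P.leadingCoeff‖ := by
        rw [le_div_iff₀ ha]
        linarith
    _ ≤ (B + D) * (1 + ‖y‖) / ‖P.leadingCoeff‖ := by
        gcongr
        nlinarith [norm_nonneg y]
    _ ≤ _ := by
        rw [add_mul 1, div_mul_eq_mul_div]
        have := norm_nonneg y
        linarith

/-- The rational function `P / Q` on the complement of its poles. -/
noncomputable def ratio (P Q : Polynomial ℂ) (z : {z : ℂ // Q.eval z ≠ 0}) : ℂ :=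
  P.eval z.1 / Q.eval z.1

theorem ratio_eq_iff {z : {z : ℂ // Q.eval z ≠ 0}} {y : ℂ} :
    ratio P Q z = y ↔ P.eval z.1 = y * Q.eval z.1 :=
  div_eq_iff z.2

theorem continuous_ratio : Continuous (ratio P Q) := by
  unfold ratio
  exact ((P.continuous.comp continuous_subtype_val).div
    (Q.continuous.comp continuous_subtype_val) fun z => z.2)

include h in
theorem isClosedMap_ratio : IsClosedMap (ratio P Q) := by
  refine (isProperMap_iff_isCompact_preimage.mpr ⟨continuous_ratio, fun K hK => ?_⟩).isClosedMap
  obtain ⟨C, hC, hC'⟩ := h.exists_norm_le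
  obtain ⟨M, hM⟩ := hK.isBounded.exists_norm_le
  -- The preimage of K is the projection of this compact set of solutions (x, y); no pole occurs in
  -- it, since P and Q have no common zero.
  have hZ : IsCompact ((Metric.closedBall (0 : ℂ) (C * (1 + M)) ×ˢ K) ∩
      {p : ℂ × ℂ | P.eval p.1 = p.2 * Q.eval p.1}) := by
    refine ((isCompact_closedBall _ _).prod hK).inter_right (isClosed_eq ?_ ?_)
    · exact P.continuous.comp continuous_fst
    · exact continuous_snd.mul (Q.continuous.comp continuous_fst)
  rw [Subtype.isCompact_iff]
  convert hZ.image continuous_fst using 1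
  ext x
  constructor
  · rintro ⟨z, hz, rfl⟩
    have e := ratio_eq_iff.mp (rfl : ratio P Q z = _)
    refine ⟨(z.1, ratio P Q z), ⟨⟨?_, hz⟩, e⟩, rfl⟩
    rw [mem_closedBall_zero_iff]
    refine (hC' _ _ e).trans ?_
    gcongr
    exact hM _ hz
  · rintro ⟨⟨x, y⟩, ⟨⟨-, hy⟩, e⟩, rfl⟩
    have hQ : Q.eval x ≠ 0 := by
      intro h0
      refine h.ne_zero x ?_ h0
      exact (e : P.eval x = y * Q.eval x).trans (by rw [h0, mul_zero])
    refine ⟨⟨x, hQ⟩, ?_, rfl⟩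
    rw [Set.mem_preimage, (ratio_eq_iff (P := P) (z := ⟨x, hQ⟩)).mpr e]
    exact hy

theorem hasStrictDerivAt_div {z : ℂ} (hz : Q.eval z ≠ 0) :
    HasStrictDerivAt (fun x => P.eval x / Q.eval x)
      ((P.derivative * Q - P * Q.derivative).eval z / Q.eval z ^ 2) z := by
  simpa using! (P.hasStrictDerivAt z).div (Q.hasStrictDerivAt z) hz

include h in
theorem deriv_ne_zero {z y : ℂ} (hz : Q.eval z ≠ 0) (hy : P.eval z = y * Q.eval z)
    (h0 : y ≠ 0) (h1 : y ≠ 1) :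
    (P.derivative * Q - P * Q.derivative).eval z / Q.eval z ^ 2 ≠ 0 := by
  refine div_ne_zero (fun hc => ?_) (pow_ne_zero 2 hz)
  rcases h.critical z hc with h' | h'
  · rw [h'] at hy
    exact mul_ne_zero h0 hz hy.symm
  · rw [h'] at hy
    exact h1 (mul_right_cancel₀ hz (by rw [one_mul]; exact hy.symm))

include h in
theorem eval_ne_zero_of_eq {z y : ℂ} (hy : P.eval z = y * Q.eval z) : Q.eval z ≠ 0 := by
  intro h0
  refine h.ne_zero z ?_ h0
  rw [hy, h0, mul_zero]

include h in
theorem finite_fiber (y : ℂ) : {x : ℂ | P.eval x = y * Q.eval x}.Finite := by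
  have hne : P - C y * Q ≠ 0 := by
    intro h0
    have h1 : P = C y * Q := sub_eq_zero.mp h0
    have := h.natDegree_lt
    rw [h1] at this
    exact absurd (natDegree_C_mul_le y Q) (not_le.mpr this)
  refine (P - C y * Q).rootSet_finite ℂ |>.subset fun x hx => ?_
  rw [mem_rootSet]
  refine ⟨hne, ?_⟩
  simp only [coe_aeval_eq_eval, eval_sub, eval_mul, eval_C]
  exact sub_eq_zero.mpr hx

include h in
-- A closed map with finite fibres is a covering over a set above which it is a local homeomorphism;
-- here the inverse function theorem applies away from the critical values.
theorem isCoveringMapOn_ratio : IsCoveringMapOn (ratio P Q) {0, 1}ᶜ := by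
  refine h.isClosedMap_ratio.isCoveringMapOn_of_isLocalHomeomorphOn (fun y _ => ?_) ?_
  · refine Set.Finite.of_finite_image ((h.finite_fiber y).subset ?_)
      (Subtype.val_injective.injOn)
    rintro _ ⟨z, hz, rfl⟩
    exact ratio_eq_iff.mp hz
  · have hopen : IsOpen {z : ℂ | Q.eval z ≠ 0} := isOpen_ne_fun Q.continuous continuous_const
    have hloc : IsLocalHomeomorphOn (fun x => P.eval x / Q.eval x)
        {z | Q.eval z ≠ 0 ∧ P.eval z / Q.eval z ∈ ({0, 1}ᶜ : Set ℂ)} := by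
      rintro z ⟨hz, hz'⟩
      have hy : P.eval z = P.eval z / Q.eval z * Q.eval z := (div_mul_cancel₀ _ hz).symm
      simp only [Set.mem_compl_iff, Set.mem_insert_iff, Set.mem_singleton_iff, not_or] at hz'
      have hd := (hasStrictDerivAt_div (P := P) hz).hasStrictFDerivAt_equiv
        (h.deriv_ne_zero hz hy hz'.1 hz'.2)
      exact ⟨_, hd.mem_toOpenPartialHomeomorph_source, by simp⟩
    exact hloc.comp (hopen.isOpenEmbedding_subtypeVal.isLocalHomeomorph.isLocalHomeomorphOn)
      fun z hz => ⟨z.2, hz⟩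

include h in
/-- Lifting functions on the upper half plane through `P / Q`. -/
theorem exists_lift {l : ℍ → ℂ} (hl : Continuous l) (hl0 : ∀ τ, l τ ≠ 0) (hl1 : ∀ τ, l τ ≠ 1)
    {a : ℍ} {x : ℂ} (hx : P.eval x = l a * Q.eval x) :
    ∃ φ : ℍ → ℂ, Continuous φ ∧ φ a = x ∧ ∀ τ, P.eval (φ τ) = l τ * Q.eval (φ τ) := by
  obtain ⟨F, ⟨hF, hF'⟩, -⟩ := h.isCoveringMapOn_ratio.existsUnique_continuousMap_lifts ⟨l, hl⟩
    (a₀ := a) (e₀ := ⟨x, h.eval_ne_zero_of_eq hx⟩) (ratio_eq_iff.mpr hx)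
    (fun τ => by simp [hl0, hl1])
  refine ⟨fun τ => F τ, continuous_subtype_val.comp F.continuous, congrArg Subtype.val hF, fun τ => ?_⟩
  exact ratio_eq_iff.mp (congrFun hF' τ)

include h in
theorem lift_unique {l : ℍ → ℂ} (hl : Continuous l) (hl0 : ∀ τ, l τ ≠ 0) (hl1 : ∀ τ, l τ ≠ 1)
    {φ ψ : ℍ → ℂ} (hφ : Continuous φ) (hψ : Continuous ψ)
    (hφ' : ∀ τ, P.eval (φ τ) = l τ * Q.eval (φ τ))
    (hψ' : ∀ τ, P.eval (ψ τ) = l τ * Q.eval (ψ τ)) {a : ℍ} (ha : φ a = ψ a) (τ : ℍ) :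
    φ τ = ψ τ := by
  have hu := (h.isCoveringMapOn_ratio.existsUnique_continuousMap_lifts ⟨l, hl⟩
    (a₀ := a) (e₀ := ⟨φ a, h.eval_ne_zero_of_eq (hφ' a)⟩) (ratio_eq_iff.mpr (hφ' a))
    (fun τ => by simp [hl0, hl1])).unique
    (y₁ := ⟨fun τ => ⟨φ τ, h.eval_ne_zero_of_eq (hφ' τ)⟩, hφ.subtype_mk _⟩)
    (y₂ := ⟨fun τ => ⟨ψ τ, h.eval_ne_zero_of_eq (hψ' τ)⟩, hψ.subtype_mk _⟩)
    ⟨rfl, _root_.funext fun τ =>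
      (ratio_eq_iff (P := P) (z := ⟨φ τ, h.eval_ne_zero_of_eq (hφ' τ)⟩)).mpr (hφ' τ)⟩
    ⟨Subtype.ext ha.symm, _root_.funext fun τ =>
      (ratio_eq_iff (P := P) (z := ⟨ψ τ, h.eval_ne_zero_of_eq (hψ' τ)⟩)).mpr (hψ' τ)⟩
  exact congrArg Subtype.val (DFunLike.congr_fun hu τ)

include h in
-- By continuity `φ` agrees near τ with a local inverse of P/Q composed with `l`.
theorem differentiableAt_lift {l : ℍ → ℂ} (hl0 : ∀ τ, l τ ≠ 0) (hl1 : ∀ τ, l τ ≠ 1)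
    {φ : ℍ → ℂ} (hφ : Continuous φ) (hφ' : ∀ τ, P.eval (φ τ) = l τ * Q.eval (φ τ)) {τ : ℍ}
    (hl : DifferentiableAt ℂ (fun z : ℂ => l (ofComplex z)) τ) :
    DifferentiableAt ℂ (fun z : ℂ => φ (ofComplex z)) τ := by
  have hQ τ : Q.eval (φ τ) ≠ 0 := h.eval_ne_zero_of_eq (hφ' τ)
  have hd := hasStrictDerivAt_div (P := P) (hQ τ)
  have hd0 := h.deriv_ne_zero (hQ τ) (hφ' τ) (hl0 τ) (hl1 τ)
  have hc : ContinuousAt (fun z : ℂ => φ (ofComplex z)) τ := by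
    have hof : ContinuousAt ofComplex (τ : ℂ) := 
      ofComplex.continuousAt (by simpa [ofComplex] using τ.im_pos)
    exact hφ.continuousAt.comp hof
  have hinv := hd.eventually_left_inverse hd0
  have hval : ∀ σ : ℍ, P.eval (φ σ) / Q.eval (φ σ) = l σ := fun σ =>
    (div_eq_iff (hQ σ)).mpr (hφ' σ)
  have hdi : DifferentiableAt ℂ (hd.localInverse _ _ _ hd0) (l (ofComplex (τ : ℂ))) := by
    have := (hd.to_localInverse hd0).hasDerivAt.differentiableAt
    rw [ofComplex_apply]
    rwa [hval] at this
  refine (hdi.comp (τ : ℂ) hl).congr_of_eventuallyEq ?_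
  have ht : Filter.Tendsto (fun z : ℂ => φ (ofComplex z)) (nhds (τ : ℂ)) (nhds (φ τ)) := by
    simpa [ContinuousAt] using hc
  filter_upwards [ht.eventually hinv] with z hz
  rw [hval] at hz
  exact hz.symm

end Polynomial.IsBelyiPair

/-! ### Periodic holomorphic functions near i∞ -/

open Filter in
theorem eventually_comap_im_of_atImInfty {p : ℍ → Prop} (hp : ∀ᶠ τ in atImInfty, p τ) :
    ∀ᶠ z in comap Complex.im atTop, p (ofComplex z) :=
  tendsto_comap_im_ofComplex.eventually hp

open Filter in
theorem eventually_differentiableAt_ofComplex {f : ℍ → ℂ}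
    (hf : ∀ τ : ℍ, DifferentiableAt ℂ (fun z : ℂ => f (ofComplex z)) τ) :
    ∀ᶠ z in comap Complex.im atTop, DifferentiableAt ℂ (fun z : ℂ => f (ofComplex z)) z := by
  filter_upwards [preimage_mem_comap (Ioi_mem_atTop 0)] with z hz
  exact hf ⟨z, hz⟩

theorem periodic_comp_ofComplex {f : ℍ → ℂ} {h : ℝ} (hf : ∀ τ : ℍ, f (h +ᵥ τ) = f τ) :
    Function.Periodic (fun z : ℂ => f (ofComplex z)) h := by
  intro z
  rcases le_or_gt z.im 0 with hz | hz
  -- Outside the half plane `ofComplex` takes a single default value.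
  · exact congrArg f (ofComplex_apply_eq_of_im_nonpos (by simpa using hz) hz)
  · have : z + h = ((h +ᵥ (⟨z, hz⟩ : ℍ) : ℍ) : ℂ) := by rw [coe_vadd, add_comm]
    simp only [this, ofComplex_apply, hf, ofComplex_apply_of_im_pos hz]

open Filter in
/-- A periodic holomorphic function of at most exponential growth is a meromorphic function of
the local parameter at `i∞`. -/
theorem exists_meromorphicAt_of_growth {f : ℍ → ℂ} {N : ℕ} (hN : 0 < N)
    (hf : ∀ τ : ℍ, DifferentiableAt ℂ (fun z : ℂ => f (ofComplex z)) τ)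
    (hper : ∀ τ : ℍ, f ((N : ℝ) +ᵥ τ) = f τ) {C : ℝ}
    (hC : ∀ᶠ τ in atImInfty, ‖f τ‖ ≤ C * Real.exp (2 * Real.pi * τ.im)) :
    ∃ F : ℂ → ℂ, MeromorphicAt F 0 ∧
      ∀ τ : ℍ, f τ = F (Complex.exp (2 * Real.pi * Complex.I * (τ : ℂ) / (N : ℂ))) := by
  have hN' : (0 : ℝ) < N := Nat.cast_pos.mpr hN
  let q : ℂ → ℂ := Function.Periodic.qParam N
  -- |q^N| = exp(-2π Im z) cancels the allowed growth, so `g` is bounded and extends over q = 0.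
  let g : ℂ → ℂ := fun z => q z ^ N * f (ofComplex z)
  have hgper : Function.Periodic g (N : ℝ) := by
    intro z
    have hq : q (z + (N : ℝ)) = q z := by
      have hN0 : (N : ℂ) ≠ 0 := Nat.cast_ne_zero.mpr hN.ne'
      simp only [q, Function.Periodic.qParam, Complex.ofReal_natCast, mul_add, add_div,
        mul_div_cancel_right₀ _ hN0]
      exact Complex.exp_periodic _
    have := periodic_comp_ofComplex hper z
    simp only [g, hq]
    simp only at this
    rw [this]
  have hgd : ∀ᶠ z in comap Complex.im atTop, DifferentiableAt ℂ g z := by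
    filter_upwards [eventually_differentiableAt_ofComplex hf] with z hz
    exact ((Function.Periodic.differentiable_qParam z).pow N).mul hz
  have hgb : BoundedAtFilter (comap Complex.im atTop) g := by
    refine Asymptotics.IsBigO.of_bound C ?_
    filter_upwards [eventually_comap_im_of_atImInfty hC,
      preimage_mem_comap (Ioi_mem_atTop (0 : ℝ))] with z hz hz0
    rw [norm_mul, norm_pow, Function.Periodic.norm_qParam, ← Real.exp_nat_mul]
    have him : (ofComplex z).im = z.im := by rw [ofComplex_apply_of_im_pos hz0]; rfl
    rw [him] at hz
    calc _ ≤ Real.exp (N * (-2 * Real.pi * z.im / N)) * (C * Real.exp (2 * Real.pi * z.im)) := by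
          gcongr
      _ = C * (Real.exp (N * (-2 * Real.pi * z.im / N)) * Real.exp (2 * Real.pi * z.im)) := by
          ring
      _ = C * ‖(1 : ℝ)‖ := by
          rw [← Real.exp_add, mul_div_cancel₀ _ hN'.ne', norm_one]
          ring_nf
          simp
      _ = _ := by simp
  have hd0 := Function.Periodic.differentiableAt_cuspFunction_zero hN' hgper hgd hgb
  have hdn := Function.Periodic.eventually_differentiableAt_cuspFunction_nhds_ne_zero
    hN' hgper hgd
  have han := Complex.analyticAt_of_differentiable_on_punctured_nhds_of_continuousAt hdn
    hd0.continuousAt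
  refine ⟨fun w => (w ^ N)⁻¹ * Function.Periodic.cuspFunction N g w,
    ((MeromorphicAt.id 0).pow N).inv.mul han.meromorphicAt, fun τ => ?_⟩
  have hq : Complex.exp (2 * Real.pi * Complex.I * (τ : ℂ) / (N : ℂ)) = q τ := by
    simp [q, Function.Periodic.qParam]
  have hq0 : q τ ≠ 0 := Function.Periodic.qParam_ne_zero _
  simp only [hq]
  rw [Function.Periodic.eq_cuspFunction hN'.ne' hgper]
  simp only [g, ofComplex_apply]
  rw [inv_mul_cancel_left₀ (pow_ne_zero N hq0)]

open Filter in
theorem exists_tendsto_atImInfty {f : ℍ → ℂ} {h : ℝ} (hh : 0 < h)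
    (hf : ∀ τ : ℍ, DifferentiableAt ℂ (fun z : ℂ => f (ofComplex z)) τ)
    (hper : ∀ τ : ℍ, f (h +ᵥ τ) = f τ) {C : ℝ} (hC : ∀ᶠ τ in atImInfty, ‖f τ‖ ≤ C) :
    ∃ L : ℂ, Tendsto f atImInfty (nhds L) := by
  have hb : BoundedAtFilter (comap Complex.im atTop) (fun z : ℂ => f (ofComplex z)) := by
    refine Asymptotics.IsBigO.of_bound C ?_
    filter_upwards [eventually_comap_im_of_atImInfty hC] with z hz
    simpa using hz
  have ht := Function.Periodic.tendsto_at_I_inf hh (periodic_comp_ofComplex hper)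
    (eventually_differentiableAt_ofComplex hf) hb
  refine ⟨_, (ht.comp tendsto_coe_atImInfty).congr fun τ => ?_⟩
  simp

/-! ### Lifts of λ: rigidity, finite index, modularity -/

theorem differentiableAt_lambdaFun_smul (g : SL(2, ℤ)) (τ : ℍ) :
    DifferentiableAt ℂ (fun z : ℂ => lambdaFun (g • ofComplex z)) τ := by
  have hd := differentiableAt_lambdaFun τ
  have h0 : lambdaFun (ofComplex (τ : ℂ)) ≠ 0 := lambdaFun_ne_zero _
  have h1 : lambdaFun (ofComplex (τ : ℂ)) - 1 ≠ 0 := sub_ne_zero.mpr (lambdaFun_ne_one _)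
  have h2 : 1 - lambdaFun (ofComplex (τ : ℂ)) ≠ 0 := sub_ne_zero.mpr (lambdaFun_ne_one _).symm
  rcases lambdaFun_smul g with h | h | h | h | h | h <;>
    obtain ⟨-, -, -, -, h⟩ := h <;> simp only [h]
  · exact hd
  · exact hd.const_sub 1
  · exact hd.div (hd.sub_const 1) h1
  · exact (differentiableAt_const 1).div (hd.const_sub 1) h2
  · exact (hd.sub_const 1).div hd h0
  · exact (differentiableAt_const 1).div hd h0

theorem continuous_SL_smul (g : SL(2, ℤ)) : Continuous (fun τ : ℍ => g • τ) :=
  continuous_const_smul (Matrix.SpecialLinearGroup.mapGL ℝ g : GL (Fin 2) ℝ)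

/-- The elements of `Γ(2)` leaving a function on the upper half plane invariant. -/
def invarianceSubgroup (φ : ℍ → ℂ) : Subgroup SL(2, ℤ) where
  carrier := {γ | γ ∈ CongruenceSubgroup.Gamma 2 ∧ ∀ τ : ℍ, φ (γ • τ) = φ τ}
  mul_mem' := fun ⟨ha, ha'⟩ ⟨hb, hb'⟩ =>
    ⟨mul_mem ha hb, fun τ => by rw [mul_smul, ha', hb']⟩
  one_mem' := ⟨one_mem _, fun τ => by rw [one_smul]⟩
  inv_mem' := fun {x} ⟨ha, ha'⟩ => ⟨inv_mem ha, fun τ => by rw [← ha', smul_inv_smul]⟩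

/-- `φ` is a continuous solution of `P(φ) = λ Q(φ)`. -/
structure IsLambdaLift (P Q : Polynomial ℂ) (φ : ℍ → ℂ) : Prop where
  continuous : Continuous φ
  eval_eq : ∀ τ, P.eval (φ τ) = lambdaFun τ * Q.eval (φ τ)

namespace IsLambdaLift

variable {P Q : Polynomial ℂ} {φ : ℍ → ℂ}

theorem eq_of_apply_eq (hφ : IsLambdaLift P Q φ) (h : P.IsBelyiPair Q) {ψ : ℍ → ℂ}
    (hψ : IsLambdaLift P Q ψ) {a : ℍ} (ha : φ a = ψ a) (τ : ℍ) : φ τ = ψ τ :=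
  h.lift_unique continuous_lambdaFun lambdaFun_ne_zero lambdaFun_ne_one hφ.continuous
    hψ.continuous hφ.eval_eq hψ.eval_eq ha τ

theorem comp_smul (hφ : IsLambdaLift P Q φ) {γ : SL(2, ℤ)}
    (hγ : γ ∈ CongruenceSubgroup.Gamma 2) : IsLambdaLift P Q (fun τ => φ (γ • τ)) where
  continuous := hφ.continuous.comp (continuous_SL_smul γ)
  eval_eq τ := by rw [hφ.eval_eq, lambdaFun_smul_of_mem_Gamma_two hγ]

theorem finiteIndex (hφ : IsLambdaLift P Q φ) (h : P.IsBelyiPair Q) :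
    ((invarianceSubgroup φ).subgroupOf (CongruenceSubgroup.Gamma 2)).FiniteIndex := by
  set H := (invarianceSubgroup φ).subgroupOf (CongruenceSubgroup.Gamma 2)
  have : Finite {x : ℂ | P.eval x = lambdaFun UpperHalfPlane.I * Q.eval x} :=
    h.finite_fiber _
  -- The inverse suits left cosets: φ(c⁻¹τ) = φ(d⁻¹τ) for all τ, taken at dτ, says that c⁻¹d fixes
  -- `φ`. Rigidity reduces this equality to τ = i.
  let e : CongruenceSubgroup.Gamma 2 ⧸ H →
      {x : ℂ | P.eval x = lambdaFun UpperHalfPlane.I * Q.eval x} := fun c =>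
    ⟨φ (((c.out)⁻¹ : CongruenceSubgroup.Gamma 2).1 • UpperHalfPlane.I),
      (hφ.comp_smul ((c.out)⁻¹ : CongruenceSubgroup.Gamma 2).2).eval_eq _⟩
  have he : Function.Injective e := by
    intro c d hcd
    have hcd' := congrArg Subtype.val hcd
    rw [← c.out_eq', ← d.out_eq', QuotientGroup.eq]
    refine Subgroup.mem_subgroupOf.mpr ⟨((c.out)⁻¹ * d.out).2, fun τ => ?_⟩
    have := (hφ.comp_smul ((c.out)⁻¹ : CongruenceSubgroup.Gamma 2).2).eq_of_apply_eq h
      (hφ.comp_smul ((d.out)⁻¹ : CongruenceSubgroup.Gamma 2).2) hcd' (d.out.1 • τ)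
    simpa [mul_smul] using this
  have : Finite (CongruenceSubgroup.Gamma 2 ⧸ H) := Finite.of_injective e he
  exact Subgroup.finiteIndex_of_finite_quotient

/-- gT²g⁻¹ lies in the normal subgroup Γ(2), so by finite index some positive power of it fixes `φ`.
-/
theorem exists_period (hφ : IsLambdaLift P Q φ) (h : P.IsBelyiPair Q) (g : SL(2, ℤ)) :
    ∃ N : ℕ, 0 < N ∧ ∀ τ : ℍ, φ (g • ((N : ℝ) +ᵥ τ)) = φ (g • τ) := by
  have hT : g * ModularGroup.T ^ 2 * g⁻¹ ∈ CongruenceSubgroup.Gamma 2 := by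
    refine (CongruenceSubgroup.Gamma_normal 2).conj_mem _ ?_ g
    exact_mod_cast CongruenceSubgroup.ModularGroup_T_pow_mem_Gamma 2 2 dvd_rfl
  obtain ⟨n, hn, -, hmem⟩ := Subgroup.exists_pow_mem_of_relIndex_ne_zero
    (hφ.finiteIndex h).index_ne_zero hT
  refine ⟨2 * n, by omega, fun τ => ?_⟩
  have h1 := hmem.1.2 (g • τ)
  rw [conj_pow, ← pow_mul, mul_smul, mul_smul, inv_smul_smul] at h1
  rw [← h1, ← zpow_natCast, modular_T_zpow_smul]
  simp

theorem differentiableAt_smul (hφ : IsLambdaLift P Q φ) (h : P.IsBelyiPair Q) (g : SL(2, ℤ))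
    (τ : ℍ) : DifferentiableAt ℂ (fun z : ℂ => φ (g • ofComplex z)) τ :=
  h.differentiableAt_lift (l := fun τ => lambdaFun (g • τ)) (φ := fun τ => φ (g • τ))
    (fun _ => lambdaFun_ne_zero _) (fun _ => lambdaFun_ne_one _)
    (hφ.continuous.comp (continuous_SL_smul g)) (fun _ => hφ.eval_eq _)
    (differentiableAt_lambdaFun_smul g τ)

theorem differentiableAt (hφ : IsLambdaLift P Q φ) (h : P.IsBelyiPair Q) (τ : ℍ) :
    DifferentiableAt ℂ (fun z : ℂ => φ (ofComplex z)) τ := by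
  simpa using hφ.differentiableAt_smul h 1 τ

theorem differentiableOn (hφ : IsLambdaLift P Q φ) (h : P.IsBelyiPair Q) :
    DifferentiableOn ℂ (fun z : ℂ => φ (ofComplex z)) {z : ℂ | 0 < z.im} :=
  fun z hz => (hφ.differentiableAt h ⟨z, hz⟩).differentiableWithinAt

theorem isMeromorphicAtCusps (hφ : IsLambdaLift P Q φ) (h : P.IsBelyiPair Q) :
    IsMeromorphicAtCusps φ := by
  intro g
  obtain ⟨N, hN, hper⟩ := hφ.exists_period h g
  obtain ⟨C, hC, hC'⟩ := h.exists_norm_le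
  obtain ⟨D, hD⟩ := exists_norm_lambdaFun_smul_le g
  have hb : ∀ᶠ τ in atImInfty,
      ‖φ (g • τ)‖ ≤ (C * (1 + |D|)) * Real.exp (2 * Real.pi * τ.im) := by
    filter_upwards [hD] with τ hτ
    have hp : 0 ≤ Real.pi * τ.im := mul_nonneg Real.pi_pos.le τ.im_pos.le
    have e1 : 1 ≤ Real.exp (2 * Real.pi * τ.im) := Real.one_le_exp (by linarith)
    have e2 : Real.exp (Real.pi * τ.im) ≤ Real.exp (2 * Real.pi * τ.im) :=
      Real.exp_le_exp.mpr (by linarith)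
    refine (hC' _ _ (hφ.eval_eq _)).trans ?_
    rw [mul_assoc, add_mul]
    gcongr
    · linarith
    · refine hτ.trans ?_
      gcongr
      exact le_abs_self D
  obtain ⟨F, hF, hF'⟩ := exists_meromorphicAt_of_growth hN (f := fun τ => φ (g • τ))
    (hφ.differentiableAt_smul h g) hper hb
  exact ⟨N, hN, F, hF, Filter.Eventually.of_forall hF'⟩

theorem isModularFunction (hφ : IsLambdaLift P Q φ) (h : P.IsBelyiPair Q) :
    IsModularFunction (invarianceSubgroup φ) φ where
  meromorphic := fun _ hz =>
    ((hφ.differentiableOn h).analyticAt (isOpen_upperHalfPlaneSet.mem_nhds hz)).meromorphicAt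
  invariant := fun _ hγ => hγ.2
  meromorphicAtCusps := hφ.isMeromorphicAtCusps h

/-- Since λ → 0, `φ` stays bounded near i∞ and, being periodic, converges; the limit of P(φ) = λQ(φ)
is P(L) = 0. -/
theorem exists_tendsto (hφ : IsLambdaLift P Q φ) (h : P.IsBelyiPair Q) :
    ∃ L : ℂ, P.eval L = 0 ∧ Filter.Tendsto φ atImInfty (nhds L) := by
  obtain ⟨N, hN, hper⟩ := hφ.exists_period h 1
  simp only [one_smul] at hper
  obtain ⟨C, hC, hC'⟩ := h.exists_norm_le
  have hb : ∀ᶠ τ in atImInfty, ‖φ τ‖ ≤ C * (1 + 1) := by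
    filter_upwards [tendsto_lambdaFun_atImInfty.norm.eventually_le_const
      (u := 1) (by norm_num)] with τ hτ
    refine (hC' _ _ (hφ.eval_eq τ)).trans ?_
    gcongr
  obtain ⟨L, hL⟩ := exists_tendsto_atImInfty (Nat.cast_pos.mpr hN) (hφ.differentiableAt h) hper hb
  refine ⟨L, ?_, hL⟩
  have h1 := (P.continuous.tendsto L).comp hL
  have h2 := tendsto_lambdaFun_atImInfty.mul ((Q.continuous.tendsto L).comp hL)
  rw [zero_mul] at h2
  exact tendsto_nhds_unique h1 (h2.congr fun τ => (hφ.eval_eq τ).symm)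

end IsLambdaLift

/-! ### The polynomials R and S -/

namespace Polynomial

variable {R S : ℝ[X]}

/-- (1) gives deg S ≤ deg R, and the parities exclude equality. -/
theorem natDegree_lt_of_comp_one_sub_X_add (hR : Odd R.natDegree) (hS : Even S.natDegree)
    (hRS : R.comp (1 - X) + R = S) : S.natDegree < R.natDegree := by
  have h1 : (1 - X : ℝ[X]).natDegree ≤ 1 := (natDegree_sub_le _ _).trans (by simp)
  have hle : S.natDegree ≤ R.natDegree := by
    rw [← hRS]
    refine (natDegree_add_le _ _).trans (max_le ?_ le_rfl)
    refine natDegree_comp_le.trans ?_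
    simpa using Nat.mul_le_mul_left R.natDegree h1
  refine lt_of_le_of_ne hle fun he => ?_
  rw [he] at hS
  exact Nat.not_even_iff_odd.mpr hR hS

theorem eval_one_sub_add (hRS : R.comp (1 - X) + R = S) (x : ℝ) :
    R.eval (1 - x) + R.eval x = S.eval x := by
  rw [← hRS]
  simp

theorem aeval_one_sub_add (hRS : R.comp (1 - X) + R = S) (x : ℂ) :
    aeval (1 - x) R + aeval x R = aeval x S := by
  rw [← hRS]
  simp [aeval_comp]

/-- RS' - R'S vanishes at common zeros and at critical points, so both can only be 0 or 1. There
R(0) = 0, S(0) = R(1) ≠ 0 and R(1) = S(1). -/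
theorem isBelyiPair_map (hR : Odd R.natDegree) (hS : Even S.natDegree)
    (hRS : R.comp (1 - X) + R = S)
    (hcrit : ∀ z : ℂ, aeval z (R * derivative S - derivative R * S) = 0 → z = 0 ∨ z = 1)
    (hSR : S.eval 1 = R.eval 1) (hR1 : R.eval 1 ≠ 0) :
    (R.map (algebraMap ℝ ℂ)).IsBelyiPair (S.map (algebraMap ℝ ℂ)) := by
  have hR0 : R.eval 0 = 0 := by
    have := eval_one_sub_add hRS 1
    rw [sub_self, hSR] at this
    linarith
  have hS0 : S.eval 0 = R.eval 1 := by
    have := eval_one_sub_add hRS 0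
    rw [sub_zero, hR0] at this
    linarith
  have c0 (p : ℝ[X]) : aeval (0 : ℂ) p = (p.eval 0 : ℝ) := by
    have := aeval_algebraMap_apply ℂ (0 : ℝ) p
    simpa using this
  have c1 (p : ℝ[X]) : aeval (1 : ℂ) p = (p.eval 1 : ℝ) := by
    have := aeval_algebraMap_apply ℂ (1 : ℝ) p
    simpa using this
  refine ⟨?_, fun z hz hz' => ?_, fun z hz => ?_⟩
  · rw [natDegree_map, natDegree_map]
    exact natDegree_lt_of_comp_one_sub_X_add hR hS hRS
  · rw [eval_map_algebraMap] at hz hz'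
    have hzc : z = 0 ∨ z = 1 := hcrit z (by simp [hz, hz'])
    rcases hzc with rfl | rfl
    · rw [c0, hS0] at hz'
      exact hR1 (by exact_mod_cast hz')
    · rw [c1] at hz
      exact hR1 (by exact_mod_cast hz)
  · simp only [eval_sub, eval_mul, derivative_map, eval_map_algebraMap] at hz ⊢
    have hzc : z = 0 ∨ z = 1 := hcrit z (by
      simp only [map_sub, map_mul]
      linear_combination -hz)
    rcases hzc with rfl | rfl
    · left
      rw [c0, hR0, Complex.ofReal_zero]
    · right
      rw [c1, c1, hSR]

/-- Another zero x would, by Rolle for R/S on [0, x], give a critical point strictly between 0 and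
1. -/
theorem eq_zero_of_eval_eq_zero_of_mem_Icc (hRS : R.comp (1 - X) + R = S)
    (hcrit : ∀ z : ℂ, aeval z (R * derivative S - derivative R * S) = 0 → z = 0 ∨ z = 1)
    (hSzero : ∀ x : ℝ, 0 < x → x < 1 → S.eval x ≠ 0)
    (hSR : S.eval 1 = R.eval 1) (hR1 : R.eval 1 ≠ 0) {x : ℝ} (hx : x ∈ Set.Icc (0 : ℝ) 1)
    (hRx : R.eval x = 0) : x = 0 := by
  have hR0 : R.eval 0 = 0 := by
    have := eval_one_sub_add hRS 1
    rw [sub_self, hSR] at this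
    linarith
  have hS0 : S.eval 0 = R.eval 1 := by
    have := eval_one_sub_add hRS 0
    rw [sub_zero, hR0] at this
    linarith
  by_contra hne
  have hx0 : 0 < x := lt_of_le_of_ne hx.1 (Ne.symm hne)
  have hx1 : x < 1 := lt_of_le_of_ne hx.2 fun h => hR1 (h ▸ hRx)
  have hSne : ∀ y ∈ Set.Icc 0 x, S.eval y ≠ 0 := by
    intro y hy
    rcases eq_or_lt_of_le hy.1 with rfl | h
    · rwa [hS0]
    · exact hSzero y h (hy.2.trans_lt hx1)
  obtain ⟨c, hc, hc'⟩ := exists_hasDerivAt_eq_zero (f := fun y => R.eval y / S.eval y)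
    (f' := fun y => ((derivative R).eval y * S.eval y - R.eval y * (derivative S).eval y) /
      S.eval y ^ 2) hx0
    (R.continuous.continuousOn.div S.continuous.continuousOn hSne) (by simp only [hR0, hRx, zero_div])
    (fun y hy => (R.hasDerivAt y).div (S.hasDerivAt y) (hSne y ⟨hy.1.le, hy.2.le⟩))
  have hSc := hSne c ⟨hc.1.le, hc.2.le⟩
  rw [div_eq_zero_iff, or_iff_left (pow_ne_zero 2 hSc)] at hc'
  have hce : (R * derivative S - derivative R * S).eval c = 0 := by
    simp only [eval_sub, eval_mul]
    linarith
  rcases hcrit c (by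
    have := aeval_algebraMap_apply ℂ c (R * derivative S - derivative R * S)
    rw [coe_aeval_eq_eval, hce, map_zero] at this
    exact this) with h | h
  · exact hc.1.ne' (by exact_mod_cast h)
  · exact (hc.2.trans hx1).ne (by exact_mod_cast h)

theorem aeval_conj_real (p : ℝ[X]) (z : ℂ) :
    aeval ((starRingEnd ℂ) z) p = (starRingEnd ℂ) (aeval z p) :=
  aeval_algHom_apply Complex.conjAe.toAlgHom z p

end Polynomial

/-! ### Symmetries of the lift with value 1/2 at i -/

namespace IsLambdaLift

open Polynomial

variable {R S : ℝ[X]} {φ : ℍ → ℂ}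

/-- 1 - φ(-1/τ) is again a lift, because λ(-1/τ) = 1 - λ(τ), R(1 - x) = S(x) - R(x) and S(1 - x) =
S(x). It agrees with `φ` at the fixed point i of S. -/
theorem add_S_smul_eq_one
    (hφ : IsLambdaLift (R.map (algebraMap ℝ ℂ)) (S.map (algebraMap ℝ ℂ)) φ)
    (h : (R.map (algebraMap ℝ ℂ)).IsBelyiPair (S.map (algebraMap ℝ ℂ)))
    (hRS : R.comp (1 - X) + R = S) (hI : φ UpperHalfPlane.I = 1 / 2) (τ : ℍ) :
    φ τ + φ (ModularGroup.S • τ) = 1 := by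
  have hψ : IsLambdaLift (R.map (algebraMap ℝ ℂ)) (S.map (algebraMap ℝ ℂ))
      (fun τ => 1 - φ (ModularGroup.S • τ)) := by
    refine ⟨continuous_const.sub (hφ.continuous.comp (continuous_SL_smul _)), fun τ => ?_⟩
    have h1 := hφ.eval_eq (ModularGroup.S • τ)
    have h2 := aeval_one_sub_add hRS (φ (ModularGroup.S • τ))
    have h3 := aeval_one_sub_add hRS (1 - φ (ModularGroup.S • τ))
    rw [sub_sub_cancel] at h3
    simp only [eval_map_algebraMap] at h1 ⊢
    rw [lambdaFun_S_smul] at h1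
    linear_combination (1 - lambdaFun τ) * h2 - h1 + lambdaFun τ * h3
  have := hφ.eq_of_apply_eq h hψ (a := UpperHalfPlane.I)
    (by simp only [S_smul_I, hI]; norm_num) τ
  linear_combination this

theorem conj_apply
    (hφ : IsLambdaLift (R.map (algebraMap ℝ ℂ)) (S.map (algebraMap ℝ ℂ)) φ)
    (h : (R.map (algebraMap ℝ ℂ)).IsBelyiPair (S.map (algebraMap ℝ ℂ)))
    (hI : φ UpperHalfPlane.I = 1 / 2) (τ : ℍ) :
    (starRingEnd ℂ) (φ τ.reflect) = φ τ := by
  have hψ : IsLambdaLift (R.map (algebraMap ℝ ℂ)) (S.map (algebraMap ℝ ℂ))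
      (fun τ => (starRingEnd ℂ) (φ τ.reflect)) := by
    refine ⟨Complex.continuous_conj.comp (hφ.continuous.comp continuous_reflect), fun τ => ?_⟩
    have h1 := hφ.eval_eq τ.reflect
    simp only [eval_map_algebraMap] at h1 ⊢
    rw [aeval_conj_real, aeval_conj_real, h1, lambdaFun_reflect, map_mul, Complex.conj_conj]
  have hIr : UpperHalfPlane.I.reflect = UpperHalfPlane.I := by
    ext
    rw [coe_reflect]
    simp
  exact hψ.eq_of_apply_eq h hφ (a := UpperHalfPlane.I)
    (by simp only [hIr, hI]; simp [Complex.conj_ofNat]) τ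

/-- The reflection fixes the imaginary axis, so `φ` is real there. It omits 0 and 1 as `λ` does, and
cannot leave the interval from φ(i) = 1/2 by the intermediate value theorem. -/
theorem im_eq_zero_and_re_mem
    (hφ : IsLambdaLift (R.map (algebraMap ℝ ℂ)) (S.map (algebraMap ℝ ℂ)) φ)
    (h : (R.map (algebraMap ℝ ℂ)).IsBelyiPair (S.map (algebraMap ℝ ℂ)))
    (h0 : (R.map (algebraMap ℝ ℂ)).eval 0 = 0)
    (h1 : (R.map (algebraMap ℝ ℂ)).eval 1 = (S.map (algebraMap ℝ ℂ)).eval 1)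
    (hI : φ UpperHalfPlane.I = 1 / 2) {t : ℝ} (ht : 0 < t) :
    (φ (ofComplex (Complex.I * t))).im = 0 ∧
      (φ (ofComplex (Complex.I * t))).re ∈ Set.Icc (0 : ℝ) 1 := by
  have him : ∀ t : ℝ, 0 < t → (φ (ofComplex (Complex.I * t))).im = 0 := by
    intro t ht
    have hp : 0 < (Complex.I * t).im := by simpa using ht
    have hr : (ofComplex (Complex.I * t)).reflect = ofComplex (Complex.I * t) := by
      ext
      rw [coe_reflect, ofComplex_apply_of_im_pos hp]
      simp
    have := hφ.conj_apply h hI (ofComplex (Complex.I * t))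
    rw [hr] at this
    exact Complex.conj_eq_iff_im.mp this
  have hne0 : ∀ τ, φ τ ≠ 0 := by
    intro τ hτ
    have e := hφ.eval_eq τ
    rw [hτ, h0] at e
    exact mul_ne_zero (lambdaFun_ne_zero τ) (h.ne_zero 0 h0) e.symm
  have hne1 : ∀ τ, φ τ ≠ 1 := by
    intro τ hτ
    have e := hφ.eval_eq τ
    have hQ := h.eval_ne_zero_of_eq e
    rw [hτ] at e hQ
    rw [h1] at e
    exact lambdaFun_ne_one τ (mul_right_cancel₀ hQ (by rw [one_mul]; exact e.symm))
  have hcont : ContinuousOn (fun t : ℝ => (φ (ofComplex (Complex.I * t))).re) (Set.Ioi 0) :=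
    (Complex.continuous_re.comp hφ.continuous).comp_continuousOn continuousOn_ofComplex_I_mul
  have hord := (isPreconnected_Ioi.image _ hcont).ordConnected
  have h1' : (φ (ofComplex (Complex.I * (1 : ℝ)))).re = 1 / 2 := by
    have : ofComplex (Complex.I * (1 : ℝ)) = UpperHalfPlane.I := by
      rw [Complex.ofReal_one, mul_one, ← UpperHalfPlane.coe_I, ofComplex_apply]
    rw [this, hI]
    norm_num
  have m1 := Set.mem_image_of_mem (fun t : ℝ => (φ (ofComplex (Complex.I * t))).re)
    (Set.mem_Ioi.mpr one_pos)
  have mt := Set.mem_image_of_mem (fun t : ℝ => (φ (ofComplex (Complex.I * t))).re)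
    (Set.mem_Ioi.mpr ht)
  simp only [h1'] at m1
  refine ⟨him t ht, ?_, ?_⟩
  · by_contra! hlt
    obtain ⟨s, hs, hs'⟩ := hord.out mt m1 ⟨hlt.le, by norm_num⟩
    exact hne0 _ (Complex.ext hs' (him s hs))
  · by_contra! hlt
    obtain ⟨s, hs, hs'⟩ := hord.out m1 mt ⟨by norm_num, hlt.le⟩
    exact hne1 _ (Complex.ext hs' (him s hs))

end IsLambdaLift

/-! ### Cusp values and the conclusion -/

open Filter in
theorem tendsto_ofComplex_I_mul_atImInfty :
    Tendsto (fun t : ℝ => ofComplex (Complex.I * t)) atTop atImInfty := by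
  refine tendsto_comap_im_ofComplex.comp (tendsto_comap_iff.mpr ?_)
  exact tendsto_id.congr fun t => by simp

theorem tendsto_SL_smul_atImInfty {g : SL(2, ℤ)} (hg : g 1 0 = 0) :
    Filter.Tendsto (fun τ : ℍ => g • τ) atImInfty atImInfty :=
  tendsto_smul_atImInfty (g := Matrix.SpecialLinearGroup.mapGL ℝ g) (by simp [hg])

theorem hasValueAtCusp_infty {φ : ℍ → ℂ} {v : ℂ} (h : Filter.Tendsto φ atImInfty (nhds v)) :
    HasValueAtCusp φ OnePoint.infty v := by
  intro g hg
  rw [OnePoint.smul_infty_eq_self_iff] at hg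
  exact h.comp (tendsto_SL_smul_atImInfty (by simpa using hg))

/-- Any g with g∞ = 0 is S times an element fixing ∞, so testing S suffices. -/
theorem hasValueAtCusp_zero {φ : ℍ → ℂ} {v : ℂ}
    (h : Filter.Tendsto (fun τ => φ (ModularGroup.S • τ)) atImInfty (nhds v)) :
    HasValueAtCusp φ ((0 : ℝ) : OnePoint ℝ) v := by
  intro g hg
  have h00 : g 0 0 = 0 := by
    rw [OnePoint.smul_infty_eq_ite] at hg
    split_ifs at hg with h10
    · exact absurd hg (OnePoint.infty_ne_coe _)
    · rw [OnePoint.coe_eq_coe, div_eq_zero_iff, or_iff_left h10] at hg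
      simpa using hg
  have h10 : (ModularGroup.S⁻¹ * g) 1 0 = 0 := by
    simp [ModularGroup.coe_S, Matrix.mul_apply, Fin.sum_univ_two, Matrix.adjugate_fin_two, h00]
  refine (h.comp (tendsto_SL_smul_atImInfty h10)).congr fun τ => ?_
  rw [Function.comp_apply, ← mul_smul, mul_inv_cancel_left]

theorem mainTheorem11 (R S : Polynomial ℝ)
    (hR : Odd R.natDegree) (hS : Even S.natDegree)
    (hRS : R.comp (1 - Polynomial.X) + R = S)
    (hcrit : ∀ z : ℂ,
      Polynomial.aeval z (R * Polynomial.derivative S - Polynomial.derivative R * S) = 0 →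
        z = 0 ∨ z = 1)
    (hSzero : ∀ x : ℝ, 0 < x → x < 1 → S.eval x ≠ 0)
    (hSR : S.eval 1 = R.eval 1) (hR1 : R.eval 1 ≠ 0) :
    ∃ (Γ : Subgroup SL(2, ℤ)) (φ : ℍ → ℂ),
      Γ ≤ CongruenceSubgroup.Gamma 2 ∧
      (Γ.subgroupOf (CongruenceSubgroup.Gamma 2)).FiniteIndex ∧
      IsModularFunction Γ φ ∧
      DifferentiableOn ℂ (fun z : ℂ => φ (ofComplex z)) {z : ℂ | 0 < z.im} ∧
      (∀ τ : ℍ, Polynomial.aeval (φ τ) R - lambdaFun τ * Polynomial.aeval (φ τ) S = 0) ∧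
      (∀ τ : ℍ, φ τ + φ (ModularGroup.S • τ) = 1) ∧
      HasValueAtCusp φ ((0 : ℝ) : OnePoint ℝ) 1 ∧
      HasValueAtCusp φ OnePoint.infty 0 ∧
      φ UpperHalfPlane.I = 1 / 2 := by
  have h := Polynomial.isBelyiPair_map hR hS hRS hcrit hSR hR1
  have hhalf : (R.map (algebraMap ℝ ℂ)).eval (1 / 2) =
      lambdaFun UpperHalfPlane.I * (S.map (algebraMap ℝ ℂ)).eval (1 / 2) := by
    have := Polynomial.aeval_one_sub_add hRS (1 / 2)
    rw [sub_half] at this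
    rw [Polynomial.eval_map_algebraMap, Polynomial.eval_map_algebraMap, lambdaFun_I, ← this]
    ring
  obtain ⟨φ, hc, hI, hev⟩ :=
    h.exists_lift continuous_lambdaFun lambdaFun_ne_zero lambdaFun_ne_one hhalf
  have hφ : IsLambdaLift (R.map (algebraMap ℝ ℂ)) (S.map (algebraMap ℝ ℂ)) φ := ⟨hc, hev⟩
  have hS1 := hφ.add_S_smul_eq_one h hRS hI
  have hcast (p : Polynomial ℝ) (x : ℝ) :
      (p.map (algebraMap ℝ ℂ)).eval (x : ℂ) = (p.eval x : ℝ) := by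
    rw [Polynomial.eval_map_algebraMap]
    exact Polynomial.aeval_algebraMap_apply ℂ x p
  have h0 : (R.map (algebraMap ℝ ℂ)).eval 0 = 0 := by
    have e := Polynomial.eval_one_sub_add hRS 1
    rw [sub_self, hSR, add_eq_right] at e
    simpa [e] using hcast R 0
  have h1 : (R.map (algebraMap ℝ ℂ)).eval 1 = (S.map (algebraMap ℝ ℂ)).eval 1 := by
    have e1 := hcast R 1
    have e2 := hcast S 1
    rw [Complex.ofReal_one] at e1 e2
    rw [e1, e2, hSR]
  obtain ⟨L, hL0, hL⟩ := hφ.exists_tendsto h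
  have hLt := hL.comp tendsto_ofComplex_I_mul_atImInfty
  have hreal : ∀ᶠ t : ℝ in Filter.atTop, (φ (ofComplex (Complex.I * t))).im = 0 ∧
      (φ (ofComplex (Complex.I * t))).re ∈ Set.Icc (0 : ℝ) 1 := by
    filter_upwards [Filter.eventually_gt_atTop 0] with t ht
    exact hφ.im_eq_zero_and_re_mem h h0 h1 hI ht
  have hLim : L.im = 0 :=
    isClosed_singleton.mem_of_tendsto ((Complex.continuous_im.tendsto L).comp hLt)
      (hreal.mono fun t ht => ht.1)
  have hLre : L.re ∈ Set.Icc (0 : ℝ) 1 :=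
    isClosed_Icc.mem_of_tendsto ((Complex.continuous_re.tendsto L).comp hLt)
      (hreal.mono fun t ht => ht.2)
  have hLe : L = (L.re : ℂ) := Complex.ext rfl hLim
  have hLz : L = 0 := by
    rw [hLe, hcast] at hL0
    rw [hLe, Polynomial.eq_zero_of_eval_eq_zero_of_mem_Icc hRS hcrit hSzero hSR hR1 hLre
      (by exact_mod_cast hL0), Complex.ofReal_zero]
  rw [hLz] at hL
  refine ⟨invarianceSubgroup φ, φ, fun γ hγ => hγ.1, hφ.finiteIndex h, hφ.isModularFunction h,
    hφ.differentiableOn h, fun τ => ?_, hS1, hasValueAtCusp_zero ?_, hasValueAtCusp_infty hL, hI⟩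
  · have e := hev τ
    rw [Polynomial.eval_map_algebraMap, Polynomial.eval_map_algebraMap] at e
    rw [e, sub_self]
  -- The value at 0 follows from the one at i∞ through φ(τ) + φ(-1/τ) = 1.
  · have := hL.const_sub 1
    rw [sub_zero] at this
    exact this.congr fun τ => by linear_combination -hS1 τ
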